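/- **Setting.** Let $d>0$, $\overline u_1>0$, $T>d/\overline u_1$ and $L=3\overline u_1T$. Let $\mathbb T_L$ be the torus $\mathbb R/(d+2L)\mathbb Z$, identified with $(-L,d+L)$ with periodic conditions. Put $$\Omega=\mathbb T_L\times(0,1),\qquad Q=\Omega\times(0,T),\qquad \omega=\big((-L,0)\times(0,1)\big)\cup\big((d,d+L]\times(0,1)\big),\qquad \omega_T=\omega\times(0,T).$$ Let $a>0$, $\gamma>1$, $\overline\rho>0$, $\mu>0$, $\nu=\mu'+2\mu>0$ and $P(\rho)=a\rho^\gamma-a\overline\rho^\gamma$. **Weights.** Let $\eta\in C^6(\mathbb T_L)$ be positive, with $|\eta'|$ bounded below by a positive constant on $\mathbb T_L\setminus\{(-3\overline u_1T,-2\overline u_1T)\cup(d+\overline u_1T,d+3\overline u_1T)\}$. Let $\eta^0(x,t)=\eta(x-\overline u_1t)$, and let $\|\eta^0\|_\infty$ be its supremum norm on $\mathbb T_L\times[0,T]$. Let $T_0,T_1>0$ satisfy $2T_0+2T_1<T-d/\overline u_1$. Let $\theta\in C^4(0,T)$ be equal to $t^{-2}$ on $(0,T_0]$, strictly decreasing on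 $[T_0,2T_0]$, equal to $1$ on $[2T_0,T-2T_1]$, strictly increasing on $[T-2T_1,T-T_1]$ and equal to $(T-t)^{-2}$ on $[T-T_1,T)$. For $\lambda\ge1$ set $$\phi(x,t)=\theta(t)\big(e^{6\lambda\|\eta^0\|_\infty}-e^{\lambda(\eta^0(x,t)+4\|\eta^0\|_\infty)}\big),\qquad \xi(x,t)=\theta(t)e^{\lambda(\eta^0(x,t)+4\|\eta^0\|_\infty)}.$$ **Equation.** For $\sigma_T\in L^2(\Omega)$ and $f_4\in L^2(Q)$, let $\sigma\in L^2(Q)$ be the weak solution of $$-\partial_t\sigma-\overline u_1\partial_x\sigma+\frac{P'(\overline\rho)}{\nu}\sigma=f_4\ \text{ in }Q,\qquad \sigma(\cdot,T)=\sigma_T\ \text{ in }\Omega .$$ This means that for every smooth, compactly supported $\psi$ on $\Omega\times(0,\infty)$, $$\iint_Q\sigma\Big(\partial_t\psi+\overline u_1\partial_x\psi+\tfrac{P'(\overline\rho)}{\nu}\psi\Big)=\iint_Q f_4\psi+\int_\Omega\sigma_T\,\psi(\cdot,T).$$ **Statement.** 1. There is a constant $C>0$ such that for all $\sigma_T\in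 L^2(\Omega)$, all $f_4\in L^2(Q)$, all $s\ge1$ and all $\lambda\ge1$, the solution $\sigma$ satisfies $$\|\xi^{-3/2}\sigma e^{-s\phi}\|^2_{L^\infty(0,T;L^2(\Omega))}\le C\Big(\|\xi^{-1/2}f_4e^{-s\phi}\|^2_{L^2(Q)}+s\lambda\|\xi^{-1/2}\sigma e^{-s\phi}\|^2_{L^2(\omega_T)}\Big).$$ 2. There is a constant $C>0$ such that for all $\sigma_T\in H^1(\Omega)$, all $f_4\in L^2(0,T;H^1(\Omega))$, all $s\ge1$ and all $\lambda\ge1$, the solution $\sigma$ belongs to $L^2(0,T;H^1(\Omega))$ and satisfies $$\|\xi^{-3/2}\nabla\sigma e^{-s\phi}\|^2_{L^\infty(0,T;L^2(\Omega))}\le C\Big(\|\xi^{-1/2}\nabla f_4e^{-s\phi}\|^2_{L^2(Q)}+s\lambda\|\xi^{-1/2}\nabla\sigma e^{-s\phi}\|^2_{L^2(\omega_T)}\Big),$$ where $\nabla=(\partial_x,\partial_z)$ is the weak spatial gradient. The constants $C$ do not depend on $\sigma_T,f_4,\sigma,s,\lambda$. -/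

import Mathlib

open MeasureTheory Set
open scoped ENNReal ContDiff

noncomputable section

namespace CarlemanTransport

/-- The one-dimensional torus identified with `(-L, d + L)` with periodic conditions. -/
abbrev Torus (d L : ℝ) : Type := AddCircle (d + 2 * L)

/-! ### Smooth functions on the torus cross-section and on the space-time cylinder

A point of the cross-section is `(x, z)`, a point of the space-time cylinder is `((x, z), t)`. -/

/-- Smoothness of a function of `(x, z)` on `Torus × ℝ`, read on the universal cover. -/
def SmoothSpace {d L : ℝ} (ψ : Torus d L × ℝ → ℝ) : Prop :=
  ContDiff ℝ ∞ (fun q : ℝ × ℝ => ψ ((q.1 : Torus d L), q.2))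

/-- Smoothness of a function of `((x, z), t)` on `(Torus × ℝ) × ℝ`, read on the universal cover. -/
def SmoothSpaceTime {d L : ℝ} (ψ : (Torus d L × ℝ) × ℝ → ℝ) : Prop :=
  ContDiff ℝ ∞ (fun q : (ℝ × ℝ) × ℝ => ψ (((q.1.1 : Torus d L), q.1.2), q.2))

/-- The derivative of a function of `(x, z)` in the torus variable `x`. -/
def spaceDx {d L : ℝ} (ψ : Torus d L × ℝ → ℝ) (p : Torus d L × ℝ) : ℝ :=
  deriv (fun h : ℝ => ψ (p.1 + (h : Torus d L), p.2)) 0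

/-- The derivative of a function of `(x, z)` in `z`. -/
def spaceDz {d L : ℝ} (ψ : Torus d L × ℝ → ℝ) (p : Torus d L × ℝ) : ℝ :=
  deriv (fun z : ℝ => ψ (p.1, z)) p.2

/-- The time derivative of a function of `((x, z), t)`. -/
def timeDt {d L : ℝ} (ψ : (Torus d L × ℝ) × ℝ → ℝ) (q : (Torus d L × ℝ) × ℝ) : ℝ :=
  deriv (fun t : ℝ => ψ (q.1, t)) q.2

/-- The `x`-derivative of a function of `((x, z), t)`. -/
def cylDx {d L : ℝ} (ψ : (Torus d L × ℝ) × ℝ → ℝ) (q : (Torus d L × ℝ) × ℝ) : ℝ :=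
  spaceDx (fun p => ψ (p, q.2)) q.1

/-- The `z`-derivative of a function of `((x, z), t)`. -/
def cylDz {d L : ℝ} (ψ : (Torus d L × ℝ) × ℝ → ℝ) (q : (Torus d L × ℝ) × ℝ) : ℝ :=
  spaceDz (fun p => ψ (p, q.2)) q.1

/-! ### Domains and measures -/

/-- Lebesgue measure on the channel `𝕋_L × (0,1)`. -/
def channelMeasure (d L : ℝ) [Fact (0 < d + 2 * L)] : Measure (Torus d L × ℝ) :=
  volume.restrict (univ ×ˢ Ioo (0 : ℝ) 1)

/-- Lebesgue measure on `Q = (𝕋_L × (0,1)) × (0,T)`. -/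
def cylMeasure (d L T : ℝ) [Fact (0 < d + 2 * L)] : Measure ((Torus d L × ℝ) × ℝ) :=
  (channelMeasure d L).prod (volume.restrict (Ioo 0 T))

/-- The observation set `ω = ((-L,0) × (0,1)) ∪ ((d,d+L] × (0,1))` in `𝕋_L × (0,1)`. -/
def obsSet (d L : ℝ) : Set (Torus d L × ℝ) :=
  ((fun x : ℝ => (x : Torus d L)) '' (Ioo (-L) 0 ∪ Ioc d (d + L))) ×ˢ Ioo (0 : ℝ) 1

/-- Lebesgue measure on `ω_T = ω × (0,T)`. -/
def obsMeasure (d L T : ℝ) [Fact (0 < d + 2 * L)] : Measure ((Torus d L × ℝ) × ℝ) :=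
  ((volume : Measure (Torus d L × ℝ)).restrict (obsSet d L)).prod (volume.restrict (Ioo 0 T))

/-! ### Sobolev regularity through weak derivatives -/

/-- `v ∈ H¹(𝕋_L × (0,1))`: `v ∈ L²` and its weak gradient is in `L²`. -/
def MemH1 {d L : ℝ} [Fact (0 < d + 2 * L)] (v : Torus d L × ℝ → ℝ) : Prop :=
  MemLp v 2 (channelMeasure d L) ∧
  ∃ g : Torus d L × ℝ → EuclideanSpace ℝ (Fin 2), MemLp g 2 (channelMeasure d L) ∧
    ∀ ψ : Torus d L × ℝ → ℝ, SmoothSpace ψ → HasCompactSupport ψ →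
      tsupport ψ ⊆ univ ×ˢ Ioo (0 : ℝ) 1 →
      (∫ p, v p * spaceDx ψ p ∂(channelMeasure d L) =
        -∫ p, g p 0 * ψ p ∂(channelMeasure d L)) ∧
      (∫ p, v p * spaceDz ψ p ∂(channelMeasure d L) =
        -∫ p, g p 1 * ψ p ∂(channelMeasure d L))

/-- `v ∈ L²(0,T;H¹(𝕋_L × (0,1)))` with weak spatial gradient `g = (∂ₓ v, ∂_z v)`. -/
structure HasL2Gradient {d L : ℝ} [Fact (0 < d + 2 * L)] (T : ℝ)
    (v : (Torus d L × ℝ) × ℝ → ℝ) (g : (Torus d L × ℝ) × ℝ → EuclideanSpace ℝ (Fin 2)) :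
    Prop where
  memLp : MemLp v 2 (cylMeasure d L T)
  memLp_grad : MemLp g 2 (cylMeasure d L T)
  weak_dx : ∀ ψ : (Torus d L × ℝ) × ℝ → ℝ, SmoothSpaceTime ψ → HasCompactSupport ψ →
    tsupport ψ ⊆ (univ ×ˢ Ioo (0 : ℝ) 1) ×ˢ Ioo (0 : ℝ) T →
    ∫ q, v q * cylDx ψ q ∂(cylMeasure d L T) = -∫ q, g q 0 * ψ q ∂(cylMeasure d L T)
  weak_dz : ∀ ψ : (Torus d L × ℝ) × ℝ → ℝ, SmoothSpaceTime ψ → HasCompactSupport ψ →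
    tsupport ψ ⊆ (univ ×ˢ Ioo (0 : ℝ) 1) ×ˢ Ioo (0 : ℝ) T →
    ∫ q, v q * cylDz ψ q ∂(cylMeasure d L T) = -∫ q, g q 1 * ψ q ∂(cylMeasure d L T)

/-! ### The adjoint transport equation -/

/-- The pressure law `P(ρ) = a ρ^γ - a ρ̄^γ`. -/
def pressure (a γ ρbar ρ : ℝ) : ℝ := a * ρ ^ γ - a * ρbar ^ γ

/-- The zero-order coefficient `P'(ρ̄) / ν`, with `ν = μ' + 2μ`. -/
def reaction (a γ ρbar μ μ' : ℝ) : ℝ := deriv (pressure a γ ρbar) ρbar / (μ' + 2 * μ)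

/-- `σ ∈ L²(Q)` is the weak solution of
`-∂ₜσ - u₁ ∂ₓσ + c σ = f` in `(𝕋_L × (0,1)) × (0,T)`, `σ(·,T) = σT` in `𝕋_L × (0,1)`.
The test functions vanish near `t = 0` but not at `t = T`, which encodes the terminal condition. -/
structure IsWeakSolution {d L : ℝ} [Fact (0 < d + 2 * L)] (u₁ c T : ℝ)
    (σT : Torus d L × ℝ → ℝ) (f σ : (Torus d L × ℝ) × ℝ → ℝ) : Prop where
  memLp : MemLp σ 2 (cylMeasure d L T)
  weak_eq : ∀ ψ : (Torus d L × ℝ) × ℝ → ℝ, SmoothSpaceTime ψ → HasCompactSupport ψ →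
    tsupport ψ ⊆ (univ ×ˢ Ioo (0 : ℝ) 1) ×ˢ Ioi (0 : ℝ) →
    ∫ q, σ q * (timeDt ψ q + u₁ * cylDx ψ q + c * ψ q) ∂(cylMeasure d L T) =
      ∫ q, f q * ψ q ∂(cylMeasure d L T) + ∫ p, σT p * ψ (p, T) ∂(channelMeasure d L)

/-! ### Carleman weights -/

/-- The requirements on the spatial weight `η`: it is `C⁶` and positive on the torus and `|η'|` is
bounded below off `(-3u₁T, -2u₁T) ∪ (d + u₁T, d + 3u₁T)`. -/
structure IsSpaceWeight {d L : ℝ} (u₁ T : ℝ) (η : Torus d L → ℝ) : Prop where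
  contDiff : ContDiff ℝ 6 (fun x : ℝ => η (x : Torus d L))
  pos : ∀ x, 0 < η x
  inf_pos : ∃ c > 0, ∀ x : ℝ,
    (x : Torus d L) ∉ (fun y : ℝ => (y : Torus d L)) ''
      (Ioo (-(3 * u₁ * T)) (-(2 * u₁ * T)) ∪ Ioo (d + u₁ * T) (d + 3 * u₁ * T)) →
    c ≤ |deriv (fun y : ℝ => η (y : Torus d L)) x|

/-- The requirements on the temporal weight `θ ∈ C⁴(0,T)`. -/
structure IsTimeWeight (T T₀ T₁ : ℝ) (θ : ℝ → ℝ) : Prop where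
  contDiffOn : ContDiffOn ℝ 4 θ (Ioo 0 T)
  eq_left : ∀ t ∈ Ioc 0 T₀, θ t = 1 / t ^ 2
  strictAntiOn : StrictAntiOn θ (Icc T₀ (2 * T₀))
  eq_one : ∀ t ∈ Icc (2 * T₀) (T - 2 * T₁), θ t = 1
  strictMonoOn : StrictMonoOn θ (Icc (T - 2 * T₁) (T - T₁))
  eq_right : ∀ t ∈ Ico (T - T₁) T, θ t = 1 / (T - t) ^ 2

/-- `η⁰(x,t) = η(x - u₁ t)`. -/
def etaZero {d L : ℝ} (u₁ : ℝ) (η : Torus d L → ℝ) (x : Torus d L) (t : ℝ) : ℝ :=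
  η (x - ((u₁ * t : ℝ) : Torus d L))

/-- `‖η⁰‖_∞`, the supremum over `𝕋_L × [0,T]`. -/
def etaSup {d L : ℝ} (u₁ T : ℝ) (η : Torus d L → ℝ) : ℝ :=
  ⨆ p : Torus d L × Icc (0 : ℝ) T, |etaZero u₁ η p.1 p.2|

/-- `φ(x,t) = θ(t) (e^{6λ‖η⁰‖_∞} - e^{λ(η⁰(x,t) + 4‖η⁰‖_∞)})`. -/
def phi {d L : ℝ} (u₁ T : ℝ) (η : Torus d L → ℝ) (θ : ℝ → ℝ) (lam : ℝ)
    (x : Torus d L) (t : ℝ) : ℝ :=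
  θ t * (Real.exp (6 * lam * etaSup u₁ T η) -
    Real.exp (lam * (etaZero u₁ η x t + 4 * etaSup u₁ T η)))

/-- `ξ(x,t) = θ(t) e^{λ(η⁰(x,t) + 4‖η⁰‖_∞)}`. -/
def xi {d L : ℝ} (u₁ T : ℝ) (η : Torus d L → ℝ) (θ : ℝ → ℝ) (lam : ℝ)
    (x : Torus d L) (t : ℝ) : ℝ :=
  θ t * Real.exp (lam * (etaZero u₁ η x t + 4 * etaSup u₁ T η))

/-- The weighted function `ξ^r e^{-sφ} v` on the space-time cylinder. -/
def weighted {d L : ℝ} {E : Type*} [NormedAddCommGroup E] [NormedSpace ℝ E]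
    (u₁ T : ℝ) (η : Torus d L → ℝ) (θ : ℝ → ℝ) (s lam r : ℝ)
    (v : (Torus d L × ℝ) × ℝ → E) (q : (Torus d L × ℝ) × ℝ) : E :=
  (xi u₁ T η θ lam q.1.1 q.2 ^ r * Real.exp (-s * phi u₁ T η θ lam q.1.1 q.2)) • v q

/-- The norm of `L^∞(0,T; L²(𝕋_L × (0,1)))`, with values in `[0,∞]`. -/
def normLinftyL2 {d L : ℝ} [Fact (0 < d + 2 * L)] {E : Type*} [NormedAddCommGroup E]
    (T : ℝ) (v : (Torus d L × ℝ) × ℝ → E) : ℝ≥0∞ :=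
  essSup (fun t : ℝ => eLpNorm (fun p : Torus d L × ℝ => v (p, t)) 2 (channelMeasure d L))
    (volume.restrict (Ioo 0 T))

end CarlemanTransport

end

open CarlemanTransport

open CarlemanTransport
namespace CarlemanTransport

section Duhamel

/-! ### Duhamel's formula along characteristics -/

/-! The equation is an ordinary differential equation along the characteristics `t ↦ x + u t`, and
`η⁰` is constant on each of them. Hence on a characteristic `ξ` and `φ` vary only through `θ(t)`:
they are `θ(t) b` and `θ(t) A`, with `b ≥ 1` and `A ≥ 0` fixed. If `1 ≤ θ(t) ≤ θ(t₀)`, the weight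
`ξ^(-3/2) e^(-sφ)` at `t₀` is therefore at most `ξ^(-1/2) e^(-sφ)` at `t` (`enorm_weight_shear_le`).

On the window `[2T₀, T - 2T₁]` one has `θ = 1`, and `θ` grows away from it on both sides, so this
comparison holds at every `t` between `t₀` and any `t₁` of the window. The window is longer than
`d/u`, the time needed to cross the unobserved strip, so each characteristic is observed there for a
time bounded below (`le_volume_obsTimes`). An energy estimate between `t₀` and an observed time
`t₁`, averaged over `t₁`, gives the estimate on one characteristic (`measure_mul_duhamel_sq_le`).
Integrating over the characteristics, whose flow preserves Lebesgue measure, gives it for solutions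
in Duhamel form (`exists_const_transportSol_le`). The argument is insensitive to the value space, so
it serves both `σ` and `∇σ`.

It remains to put weak solutions in Duhamel form. By duality, a test function `χ` is written as `∂ₜψ
+ u ∂ₓψ + c ψ` on `(0,T)` with an admissible `ψ` (`adjointSol`); the pairing of `σ` with `χ` is then
determined by the data (`IsWeakSolution.ae_eq_transportSol`). Since the coefficients are constant,
testing with spatial derivatives of `ψ` shows that the Duhamel solution with data `∇f`, `∇σ_T` is
the weak gradient of `σ` (`IsWeakSolution.hasL2Gradient`). -/

/-- The solution of `-∂ₜS + c S = F`, `S(T) = a`, with a parameter. -/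
noncomputable def duhamel {P E : Type*} [NormedAddCommGroup E] [NormedSpace ℝ E] (c T : ℝ)
    (a : P → E) (F : P × ℝ → E) (q : P × ℝ) : E :=
  Real.exp (-c * (T - q.2)) • a q.1 +
    ∫ τ in q.2..T, Real.exp (-c * (τ - q.2)) • F (q.1, τ)

theorem eLpNorm_two_sq {α E : Type*} [MeasurableSpace α] [NormedAddCommGroup E] (f : α → E)
    (μ : Measure α) : eLpNorm f 2 μ ^ 2 = ∫⁻ x, ‖f x‖ₑ ^ 2 ∂μ := by
  have h := eLpNorm_nnreal_pow_eq_lintegral (f := f) (μ := μ) (p := 2) (by norm_num)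
  have h2 : ((2 : NNReal) : ℝ) = ((2 : ℕ) : ℝ) := by norm_num
  rw [h2] at h
  simpa only [ENNReal.rpow_natCast, ENNReal.coe_ofNat] using h

theorem memLp_two_of_lintegral_lt_top {α E : Type*} [MeasurableSpace α] [NormedAddCommGroup E]
    {f : α → E} {μ : Measure α} (hf : AEStronglyMeasurable f μ)
    (h : ∫⁻ x, ‖f x‖ₑ ^ 2 ∂μ < ⊤) : MemLp f 2 μ := by
  refine ⟨hf, ?_⟩
  rw [← eLpNorm_two_sq] at h
  by_contra hc
  rw [not_lt, top_le_iff] at hc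
  simp [hc] at h

theorem lintegral_enorm_sq_lt_top_of_memLp {α E : Type*} [MeasurableSpace α] [NormedAddCommGroup E]
    {f : α → E} {μ : Measure α} (hf : MemLp f 2 μ) : ∫⁻ x, ‖f x‖ₑ ^ 2 ∂μ < ⊤ := by
  rw [← eLpNorm_two_sq]
  exact ENNReal.pow_lt_top hf.2

theorem ennreal_add_sq_le_two_mul (a b : ℝ≥0∞) : (a + b) ^ 2 ≤ 2 * (a ^ 2 + b ^ 2) := by
  have h := ENNReal.rpow_add_le_mul_rpow_add_rpow a b (p := 2) (by norm_num)
  norm_num at h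
  exact h

theorem lintegral_enorm_sq_le {α E : Type*} [MeasurableSpace α] [NormedAddCommGroup E]
    {f : α → E} {μ : Measure α} (hf : AEStronglyMeasurable f μ) :
    (∫⁻ x, ‖f x‖ₑ ∂μ) ^ 2 ≤ μ univ * ∫⁻ x, ‖f x‖ₑ ^ 2 ∂μ := by
  have h := eLpNorm_le_eLpNorm_mul_rpow_measure_univ (p := 1) (q := 2) (by norm_num) hf
  rw [eLpNorm_one_eq_lintegral_enorm] at h
  calc (∫⁻ x, ‖f x‖ₑ ∂μ) ^ 2 ≤ _ := pow_le_pow_left' h 2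
    _ = μ univ * ∫⁻ x, ‖f x‖ₑ ^ 2 ∂μ := by
      rw [mul_pow, eLpNorm_two_sq, mul_comm, ← ENNReal.rpow_natCast, ← ENNReal.rpow_mul]
      norm_num

theorem exp_le_exp_abs_mul {c r T : ℝ} (hr : |r| ≤ T) :
    Real.exp (-c * r) ≤ Real.exp (|c| * T) := by
  apply Real.exp_le_exp.2
  calc -c * r ≤ |-c * r| := le_abs_self _
    _ = |c| * |r| := by rw [abs_mul, abs_neg]
    _ ≤ _ := by gcongr

variable {P E : Type*} [NormedAddCommGroup E]

theorem ae_integrableOn_slice_of_memLp [MeasurableSpace P] {m : Measure P}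
    [IsFiniteMeasure m] {F : P × ℝ → E} {T : ℝ}
    (hF : MemLp F 2 (m.prod (volume.restrict (Ioo 0 T)))) :
    ∀ᵐ p ∂m, IntegrableOn (fun τ => F (p, τ)) (Ioo 0 T) :=
  (hF.integrable (by norm_num)).prod_right_ae

/-- Duality between the backward and the forward equation on one characteristic. -/
theorem integral_duhamel_mul_slice {a : P → ℝ} {F : P × ℝ → ℝ} {c T B : ℝ} {p : P} (hT : 0 ≤ T)
    (hF : IntegrableOn (fun τ => F (p, τ)) (Ioo 0 T)) {h Ψ : ℝ → ℝ} (hh : Measurable h)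
    (hB : ∀ t, |h t| ≤ B)
    (hΨ : ∀ t ∈ Icc 0 T, Ψ t = ∫ τ in 0..t, Real.exp (-c * (t - τ)) * h τ) :
    ∫ t in Ioo 0 T, duhamel c T a F (p, t) * h t =
      (∫ t in Ioo 0 T, F (p, t) * Ψ t) + a p * Ψ T := by
  set ν : Measure ℝ := volume.restrict (Ioo 0 T) with hν
  -- The double integral over the triangle `t < τ` is evaluated in both orders: integration in `τ`
  -- produces the Duhamel integral, integration in `t` produces `Ψ τ`.
  set k : ℝ → ℝ → ℝ := fun t τ =>
    (Ioi t).indicator (fun τ => Real.exp (-c * (τ - t)) * h t * F (p, τ)) τ with hk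
  have hFs : Integrable (fun r : ℝ × ℝ => F (p, r.2)) (ν.prod ν) :=
    Integrable.comp_snd (f := fun τ => F (p, τ)) hF ν
  have hs : MeasurableSet {r : ℝ × ℝ | r.1 < r.2} := measurableSet_lt measurable_fst measurable_snd
  have hmem : ∀ᵐ r ∂ν.prod ν, r.1 ∈ Ioo 0 T ∧ r.2 ∈ Ioo 0 T :=
    ((Measure.quasiMeasurePreserving_fst (μ := ν) (ν := ν)).ae
      (ae_restrict_mem measurableSet_Ioo)).and
    ((Measure.quasiMeasurePreserving_snd (μ := ν) (ν := ν)).ae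
      (ae_restrict_mem measurableSet_Ioo))
  have hki : Integrable (Function.uncurry k) (ν.prod ν) := by
    have h1 : Integrable (fun r : ℝ × ℝ => Real.exp (-c * (r.2 - r.1)) * h r.1 * F (p, r.2))
        (ν.prod ν) := by
      refine hFs.bdd_mul (c := Real.exp (|c| * T) * B)
        (Measurable.aestronglyMeasurable (by fun_prop)) ?_
      filter_upwards [hmem] with r hr
      rw [norm_mul, Real.norm_eq_abs, Real.norm_eq_abs, Real.abs_exp]
      refine mul_le_mul (exp_le_exp_abs_mul ?_) (hB _) (abs_nonneg _) (Real.exp_nonneg _)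
      rw [abs_le]; constructor <;> linarith [hr.1.1, hr.1.2, hr.2.1, hr.2.2]
    exact h1.indicator hs
  have hE : Integrable (fun t => Real.exp (-c * (T - t)) * h t) ν := by
    refine Integrable.of_bound (Measurable.aestronglyMeasurable (by fun_prop))
      (Real.exp (|c| * T) * B) ?_
    filter_upwards [ae_restrict_mem measurableSet_Ioo] with t ht
    rw [norm_mul, Real.norm_eq_abs, Real.norm_eq_abs, Real.abs_exp]
    refine mul_le_mul (exp_le_exp_abs_mul ?_) (hB _) (abs_nonneg _) (Real.exp_nonneg _)
    rw [abs_le]; constructor <;> linarith [ht.1, ht.2]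
  have hS : ∀ t ∈ Ioo 0 T, duhamel c T a F (p, t) * h t =
      a p * (Real.exp (-c * (T - t)) * h t) + ∫ τ, k t τ ∂ν := by
    intro t ht
    have hset : Ioi t ∩ Ioo 0 T = Ioo t T := by
      ext τ
      simp only [mem_inter_iff, mem_Ioi, mem_Ioo]
      exact ⟨fun h => ⟨h.1, h.2.2⟩, fun h => ⟨h.1, ht.1.trans h.1, h.2⟩⟩
    simp only [hk]
    rw [integral_indicator measurableSet_Ioi, hν, Measure.restrict_restrict measurableSet_Ioi,
      hset, ← integral_Ioc_eq_integral_Ioo, ← intervalIntegral.integral_of_le ht.2.le]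
    simp only [duhamel, smul_eq_mul]
    rw [add_mul, ← intervalIntegral.integral_mul_const]
    congr 1
    · ring
    · congr 1; ext τ; ring
  have hD : ∀ τ ∈ Ioo 0 T, ∫ t, k t τ ∂ν = F (p, τ) * Ψ τ := by
    intro τ hτ
    have hset : Iio τ ∩ Ioo 0 T = Ioo 0 τ := by
      ext t
      simp only [mem_inter_iff, mem_Iio, mem_Ioo]
      exact ⟨fun h => ⟨h.2.1, h.1⟩, fun h => ⟨h.2, h.1, h.2.trans hτ.2⟩⟩
    have hk' : (fun t => k t τ) =
        (Iio τ).indicator fun t => F (p, τ) * (Real.exp (-c * (τ - t)) * h t) := by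
      ext t
      simp only [hk, indicator, mem_Ioi, mem_Iio]
      split_ifs
      · ring
      · rfl
    rw [hk', integral_indicator measurableSet_Iio, hν, Measure.restrict_restrict measurableSet_Iio,
      hset, ← integral_Ioc_eq_integral_Ioo, ← intervalIntegral.integral_of_le hτ.1.le,
      intervalIntegral.integral_const_mul, hΨ τ (Ioo_subset_Icc_self hτ)]
  have hadd := integral_add (g := fun t => ∫ τ, k t τ ∂ν) (hE.const_mul (a p))
    hki.integral_prod_left
  rw [setIntegral_congr_fun measurableSet_Ioo hS, hadd, integral_integral_swap hki,
    setIntegral_congr_fun measurableSet_Ioo hD, integral_const_mul, hΨ T (right_mem_Icc.2 hT),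
    hν, ← integral_Ioc_eq_integral_Ioo, ← intervalIntegral.integral_of_le hT, add_comm]

variable [NormedSpace ℝ E]

theorem intervalIntegrable_exp_smul {G : ℝ → E} {T t₀ t₁ : ℝ} (c r : ℝ)
    (hG : IntegrableOn G (Ioo 0 T)) (h₀ : t₀ ∈ Icc 0 T) (h₁ : t₁ ∈ Icc 0 T) :
    IntervalIntegrable (fun τ => Real.exp (-c * (τ - r)) • G τ) volume t₀ t₁ := by
  have h : IntervalIntegrable G volume t₀ t₁ := by
    rw [intervalIntegrable_iff_integrableOn_Ioo_of_le (le_trans h₀.1 h₀.2)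
      |>.symm] at hG
    refine hG.mono_set ?_
    rw [uIcc_of_le (le_trans h₀.1 h₀.2)]
    exact uIcc_subset_Icc h₀ h₁
  exact h.continuousOn_smul (by fun_prop)

/-- Flow property of the equation. The two times are not ordered, because the observed time may
precede or follow `t₀`. -/
theorem duhamel_eq_duhamel {a : P → E} {F : P × ℝ → E} {c T : ℝ} {p : P} {t₀ t₁ : ℝ}
    (hF : IntegrableOn (fun τ => F (p, τ)) (Ioo 0 T)) (h₀ : t₀ ∈ Icc 0 T) (h₁ : t₁ ∈ Icc 0 T) :
    duhamel c T a F (p, t₀) = Real.exp (-c * (t₁ - t₀)) • duhamel c T a F (p, t₁) +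
      ∫ τ in t₀..t₁, Real.exp (-c * (τ - t₀)) • F (p, τ) := by
  have hT : T ∈ Icc 0 T := ⟨h₀.1.trans h₀.2, le_rfl⟩
  have key : ∀ τ : ℝ, Real.exp (-c * (τ - t₀)) =
      Real.exp (-c * (t₁ - t₀)) * Real.exp (-c * (τ - t₁)) := by
    intro τ; rw [← Real.exp_add]; congr 1; ring
  simp only [duhamel]
  rw [smul_add, smul_smul, ← key, ← intervalIntegral.integral_smul]
  simp only [smul_smul, ← key]
  rw [add_assoc, add_comm (∫ τ in t₁..T, _),
    intervalIntegral.integral_add_adjacent_intervals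
      (intervalIntegrable_exp_smul c t₀ hF h₀ h₁) (intervalIntegrable_exp_smul c t₀ hF h₁ hT)]

/-- The constant of the energy estimate along a characteristic. -/
noncomputable def energyConst (c T : ℝ) : ℝ≥0∞ :=
  2 * (ENNReal.ofReal (Real.exp (|c| * T)) ^ 2 * (1 + ENNReal.ofReal T))

theorem energyConst_ne_top (c T : ℝ) : energyConst c T ≠ ⊤ := by
  unfold energyConst
  finiteness

/-- The flow property is squared: the factor `2` comes from `(x + y)² ≤ 2(x² + y²)`, the exponential
bounds the propagator in both time directions, and `T` comes from Cauchy–Schwarz on the source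
integral. -/
theorem enorm_duhamel_sq_le {a : P → E} {F : P × ℝ → E} {c T : ℝ} {p : P} {t₀ t₁ : ℝ}
    (hF : IntegrableOn (fun τ => F (p, τ)) (Ioo 0 T)) (h₀ : t₀ ∈ Icc 0 T) (h₁ : t₁ ∈ Icc 0 T) :
    ‖duhamel c T a F (p, t₀)‖ₑ ^ 2 ≤ energyConst c T * (‖duhamel c T a F (p, t₁)‖ₑ ^ 2 +
      ∫⁻ τ in uIoc t₀ t₁, ‖F (p, τ)‖ₑ ^ 2) := by
  set M : ℝ≥0∞ := ENNReal.ofReal (Real.exp (|c| * T)) with hM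
  have hsub : uIoc t₀ t₁ ⊆ Ioc 0 T := by
    intro τ hτ
    rcases hτ with ⟨h1, h2⟩
    exact ⟨(le_min h₀.1 h₁.1).trans_lt h1, h2.trans (max_le h₀.2 h₁.2)⟩
  have hexp : ∀ τ ∈ Icc 0 T, ‖Real.exp (-c * (τ - t₀))‖ₑ ≤ M := by
    intro τ hτ
    rw [Real.enorm_eq_ofReal (Real.exp_nonneg _), hM]
    refine ENNReal.ofReal_le_ofReal (exp_le_exp_abs_mul ?_)
    rw [abs_le]; constructor <;> linarith [hτ.1, hτ.2, h₀.1, h₀.2]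
  have hint : ‖∫ τ in t₀..t₁, Real.exp (-c * (τ - t₀)) • F (p, τ)‖ₑ ≤
      M * ∫⁻ τ in uIoc t₀ t₁, ‖F (p, τ)‖ₑ := by
    have h1 : ‖∫ τ in t₀..t₁, Real.exp (-c * (τ - t₀)) • F (p, τ)‖ₑ =
        ‖∫ τ in uIoc t₀ t₁, Real.exp (-c * (τ - t₀)) • F (p, τ)‖ₑ := by
      rw [← ofReal_norm, ← ofReal_norm, intervalIntegral.norm_intervalIntegral_eq]
    rw [h1]
    refine (enorm_integral_le_lintegral_enorm _).trans ?_
    rw [← lintegral_const_mul' _ _ ENNReal.ofReal_ne_top]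
    refine setLIntegral_mono' measurableSet_uIoc fun τ hτ => ?_
    rw [enorm_smul]
    gcongr
    exact hexp τ (Ioc_subset_Icc_self (hsub hτ))
  have hmeas : AEStronglyMeasurable (fun τ => F (p, τ)) (volume.restrict (uIoc t₀ t₁)) := by
    have : IntegrableOn (fun τ => F (p, τ)) (Ioc 0 T) := by
      rwa [integrableOn_Ioc_iff_integrableOn_Ioo]
    exact (this.mono_set hsub).aestronglyMeasurable
  have hvol : volume.restrict (uIoc t₀ t₁) univ ≤ ENNReal.ofReal T := by
    rw [Measure.restrict_apply_univ]
    exact (measure_mono hsub).trans (by simp)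
  rw [duhamel_eq_duhamel hF h₀ h₁]
  calc _ ≤ (M * ‖duhamel c T a F (p, t₁)‖ₑ + M * ∫⁻ τ in uIoc t₀ t₁, ‖F (p, τ)‖ₑ) ^ 2 := by
        gcongr
        refine (enorm_add_le _ _).trans ?_
        rw [enorm_smul]
        gcongr
        exact hexp t₁ h₁
    _ ≤ 2 * ((M * ‖duhamel c T a F (p, t₁)‖ₑ) ^ 2 +
          (M * ∫⁻ τ in uIoc t₀ t₁, ‖F (p, τ)‖ₑ) ^ 2) := ennreal_add_sq_le_two_mul _ _
    _ ≤ 2 * (M ^ 2 * (1 * ‖duhamel c T a F (p, t₁)‖ₑ ^ 2) +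
          M ^ 2 * (ENNReal.ofReal T * ∫⁻ τ in uIoc t₀ t₁, ‖F (p, τ)‖ₑ ^ 2)) := by
        rw [mul_pow, mul_pow, one_mul]
        gcongr
        exact (lintegral_enorm_sq_le hmeas).trans (by gcongr)
    _ ≤ 2 * (M ^ 2 * ((1 + ENNReal.ofReal T) * ‖duhamel c T a F (p, t₁)‖ₑ ^ 2) +
          M ^ 2 * ((1 + ENNReal.ofReal T) * ∫⁻ τ in uIoc t₀ t₁, ‖F (p, τ)‖ₑ ^ 2)) := by
        gcongr
        · exact le_self_add
        · exact le_add_self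
    _ = _ := by unfold energyConst; ring

/-- The weighted estimate on one characteristic: the weights `w₀`, `w₁` satisfy `w₀(t₀) ≤ w₁(t)`
for every `t` between `t₀` and a time of the observation window `G`. -/
theorem measure_mul_duhamel_sq_le {a : P → E} {F : P × ℝ → E} {c T : ℝ} {p : P} {t₀ : ℝ}
    (hF : IntegrableOn (fun τ => F (p, τ)) (Ioo 0 T)) (h₀ : t₀ ∈ Ioo 0 T)
    {G : Set ℝ} (hG : MeasurableSet G) (hGT : G ⊆ Ioo 0 T) (w₀ : ℝ≥0∞) (w₁ : ℝ → ℝ≥0∞)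
    (hw₀ : w₀ ≠ ⊤) (hw : ∀ t₁ ∈ G, ∀ t ∈ uIcc t₀ t₁, w₀ ≤ w₁ t) :
    volume G * (w₀ * ‖duhamel c T a F (p, t₀)‖ₑ ^ 2) ≤ energyConst c T *
      ((∫⁻ t in G, w₁ t * ‖duhamel c T a F (p, t)‖ₑ ^ 2) +
        ENNReal.ofReal T * ∫⁻ t in Ioo 0 T, w₁ t * ‖F (p, t)‖ₑ ^ 2) := by
  have key : ∀ t₁ ∈ G, w₀ * ‖duhamel c T a F (p, t₀)‖ₑ ^ 2 ≤ energyConst c T *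
      (w₁ t₁ * ‖duhamel c T a F (p, t₁)‖ₑ ^ 2 + ∫⁻ t in Ioo 0 T, w₁ t * ‖F (p, t)‖ₑ ^ 2) := by
    intro t₁ ht₁
    have h₁ := hGT ht₁
    have hsub : uIoc t₀ t₁ ⊆ Ioo 0 T := by
      intro τ hτ
      exact ⟨(lt_min h₀.1 h₁.1).trans hτ.1, hτ.2.trans_lt (max_lt h₀.2 h₁.2)⟩
    calc w₀ * ‖duhamel c T a F (p, t₀)‖ₑ ^ 2 ≤ w₀ * (energyConst c T *
          (‖duhamel c T a F (p, t₁)‖ₑ ^ 2 + ∫⁻ τ in uIoc t₀ t₁, ‖F (p, τ)‖ₑ ^ 2)) := by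
          gcongr
          exact enorm_duhamel_sq_le hF (Ioo_subset_Icc_self h₀) (Ioo_subset_Icc_self h₁)
      _ = energyConst c T * (w₀ * ‖duhamel c T a F (p, t₁)‖ₑ ^ 2 +
          ∫⁻ τ in uIoc t₀ t₁, w₀ * ‖F (p, τ)‖ₑ ^ 2) := by
          rw [lintegral_const_mul' _ _ hw₀]; ring
      -- The fixed weight `w₀` now sits inside the time integral, so it can be replaced by `w₁ t` at
      -- each intermediate time. This is why the comparison is assumed on all of `uIcc t₀ t₁`.
      _ ≤ _ := by
          refine mul_le_mul_right (add_le_add ?_ ?_) _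
          · exact mul_le_mul_left (hw t₁ ht₁ t₁ right_mem_uIcc) _
          · refine (setLIntegral_mono' measurableSet_uIoc fun t ht => ?_).trans
              (lintegral_mono_set hsub)
            gcongr
            exact hw t₁ ht₁ t (uIoc_subset_uIcc ht)
  -- Average of `key` over the observed times: the left side does not depend on `t₁`, and the
  -- pointwise value at `t₁` becomes an integral over `G`.
  calc volume G * (w₀ * ‖duhamel c T a F (p, t₀)‖ₑ ^ 2)
      = ∫⁻ _ in G, w₀ * ‖duhamel c T a F (p, t₀)‖ₑ ^ 2 := by
        rw [setLIntegral_const, mul_comm]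
    _ ≤ ∫⁻ t₁ in G, energyConst c T * (w₁ t₁ * ‖duhamel c T a F (p, t₁)‖ₑ ^ 2 +
          ∫⁻ t in Ioo 0 T, w₁ t * ‖F (p, t)‖ₑ ^ 2) := setLIntegral_mono' hG key
    _ = energyConst c T * ((∫⁻ t in G, w₁ t * ‖duhamel c T a F (p, t)‖ₑ ^ 2) +
          volume G * ∫⁻ t in Ioo 0 T, w₁ t * ‖F (p, t)‖ₑ ^ 2) := by
        rw [lintegral_const_mul' _ _ (energyConst_ne_top c T),
          lintegral_add_right _ measurable_const, setLIntegral_const, mul_comm (volume G)]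
    _ ≤ _ := by
        gcongr
        exact (measure_mono hGT).trans (by simp)

variable [MeasurableSpace P] {m : Measure P} [IsFiniteMeasure m]

theorem aestronglyMeasurable_duhamel {a : P → E} {F : P × ℝ → E} {c T : ℝ}
    (ha : AEStronglyMeasurable a m)
    (hF : AEStronglyMeasurable F (m.prod (volume.restrict (Ioo 0 T)))) :
    AEStronglyMeasurable (duhamel c T a F) (m.prod (volume.restrict (Ioo 0 T))) := by
  set ν : Measure ℝ := volume.restrict (Ioo 0 T) with hν
  have h1 : AEStronglyMeasurable (fun q : P × ℝ => Real.exp (-c * (T - q.2)) • a q.1)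
      (m.prod ν) := by
    refine AEStronglyMeasurable.smul (Measurable.aestronglyMeasurable (by fun_prop)) ?_
    exact ha.comp_fst
  -- The moving interval of integration is encoded by an indicator, so that measurability follows
  -- from that of parametric integrals against a fixed measure.
  have h2 : AEStronglyMeasurable (fun r : (P × ℝ) × ℝ =>
      (Ioc r.1.2 T).indicator (fun τ => Real.exp (-c * (τ - r.1.2)) • F (r.1.1, τ)) r.2)
      ((m.prod ν).prod ν) := by
    have hF' : AEStronglyMeasurable (fun r : (P × ℝ) × ℝ => F (r.1.1, r.2))
        ((m.prod ν).prod ν) := by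
      refine hF.comp_quasiMeasurePreserving
        (QuasiMeasurePreserving.prodMap ?_ (Measure.QuasiMeasurePreserving.id ν))
      exact Measure.quasiMeasurePreserving_fst
    have hs : MeasurableSet {r : (P × ℝ) × ℝ | r.1.2 < r.2 ∧ r.2 ≤ T} :=
      (measurableSet_lt (f := fun r : (P × ℝ) × ℝ => r.1.2) (g := fun r => r.2)
        (by fun_prop) (by fun_prop)).inter
        (measurableSet_le (f := fun r : (P × ℝ) × ℝ => r.2) (by fun_prop) (by fun_prop))
    have hm : AEStronglyMeasurable (fun r : (P × ℝ) × ℝ =>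
        Real.exp (-c * (r.2 - r.1.2)) • F (r.1.1, r.2)) ((m.prod ν).prod ν) :=
      AEStronglyMeasurable.smul (Measurable.aestronglyMeasurable (by fun_prop)) hF'
    exact hm.indicator hs
  refine (h1.add h2.integral_prod_right').congr ?_
  have hmem : ∀ᵐ q ∂m.prod ν, q.2 ∈ Ioo 0 T :=
    (Measure.quasiMeasurePreserving_snd (μ := m) (ν := ν)).ae
      (ae_restrict_mem measurableSet_Ioo)
  filter_upwards [hmem] with q hq
  simp only [duhamel, Pi.add_apply]
  congr 1
  have hset : Ioc q.2 T ∩ Ioo 0 T = Ioo q.2 T := by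
    ext τ
    simp only [mem_inter_iff, mem_Ioc, mem_Ioo]
    exact ⟨fun h => ⟨h.1.1, h.2.2⟩, fun h => ⟨⟨h.1, h.2.le⟩, hq.1.trans h.1, h.2⟩⟩
  rw [intervalIntegral.integral_of_le hq.2.le, integral_indicator measurableSet_Ioc, hν,
    Measure.restrict_restrict measurableSet_Ioc, hset, integral_Ioc_eq_integral_Ioo]

/-- This is the energy estimate with `t₁ = T`, where the Duhamel expression reduces to `a`. -/
theorem memLp_duhamel {a : P → E} {F : P × ℝ → E} {c T : ℝ} (hT : 0 ≤ T) (ha : MemLp a 2 m)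
    (hF : MemLp F 2 (m.prod (volume.restrict (Ioo 0 T)))) :
    MemLp (duhamel c T a F) 2 (m.prod (volume.restrict (Ioo 0 T))) := by
  have hS := aestronglyMeasurable_duhamel (c := c) ha.1 hF.1
  refine memLp_two_of_lintegral_lt_top hS ?_
  have hFm : AEMeasurable (fun q => ‖F q‖ₑ ^ 2) (m.prod (volume.restrict (Ioo 0 T))) :=
    hF.1.enorm.pow_const 2
  have hfin := lintegral_enorm_sq_lt_top_of_memLp hF
  have hfina := lintegral_enorm_sq_lt_top_of_memLp ha
  rw [lintegral_prod _ hFm] at hfin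
  rw [lintegral_prod _ (hS.enorm.pow_const 2)]
  have hle : ∀ᵐ p ∂m, ∫⁻ t in Ioo 0 T, ‖duhamel c T a F (p, t)‖ₑ ^ 2 ≤
      ENNReal.ofReal T * (energyConst c T *
        (‖a p‖ₑ ^ 2 + ∫⁻ t in Ioo 0 T, ‖F (p, t)‖ₑ ^ 2)) := by
    filter_upwards [ae_integrableOn_slice_of_memLp hF] with p hp
    calc ∫⁻ t in Ioo 0 T, ‖duhamel c T a F (p, t)‖ₑ ^ 2
        ≤ ∫⁻ _ in Ioo 0 T, energyConst c T *
          (‖a p‖ₑ ^ 2 + ∫⁻ t in Ioo 0 T, ‖F (p, t)‖ₑ ^ 2) := by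
          refine setLIntegral_mono' measurableSet_Ioo fun t ht => ?_
          refine (enorm_duhamel_sq_le hp (Ioo_subset_Icc_self ht) (right_mem_Icc.2 hT)).trans ?_
          refine mul_le_mul_right (add_le_add (by simp [duhamel]) ?_) _
          rw [uIoc_of_le ht.2.le, restrict_Ioo_eq_restrict_Ioc]
          exact lintegral_mono_set (Ioc_subset_Ioc_left ht.1.le)
      _ = _ := by rw [setLIntegral_const, mul_comm]; simp
  refine (lintegral_mono_ae hle).trans_lt ?_
  rw [lintegral_const_mul' _ _ ENNReal.ofReal_ne_top,
    lintegral_const_mul' _ _ (energyConst_ne_top c T),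
    lintegral_add_left' (ha.1.enorm.pow_const 2)]
  exact ENNReal.mul_lt_top ENNReal.ofReal_lt_top (ENNReal.mul_lt_top
    (energyConst_ne_top c T).lt_top (ENNReal.add_lt_top.2 ⟨hfina, hfin⟩))

theorem integral_duhamel_mul {a : P → ℝ} {F : P × ℝ → ℝ} {c T B : ℝ} (hT : 0 ≤ T)
    (ha : MemLp a 2 m) (hF : MemLp F 2 (m.prod (volume.restrict (Ioo 0 T))))
    {χ Ψ : P × ℝ → ℝ} (hχ : Measurable χ) (hΨm : Measurable Ψ)
    (hB : ∀ q, |χ q| ≤ B) (hΨB : ∀ q, |Ψ q| ≤ B)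
    (hΨ : ∀ p, ∀ t ∈ Icc 0 T, Ψ (p, t) = ∫ τ in 0..t, Real.exp (-c * (t - τ)) * χ (p, τ)) :
    ∫ q, duhamel c T a F q * χ q ∂(m.prod (volume.restrict (Ioo 0 T))) =
      (∫ q, F q * Ψ q ∂(m.prod (volume.restrict (Ioo 0 T)))) + ∫ p, a p * Ψ (p, T) ∂m := by
  have hS := (memLp_duhamel (c := c) hT ha hF).integrable (by norm_num)
  have hFi := hF.integrable (by norm_num)
  have hai := ha.integrable (by norm_num)
  have h1 := hS.mul_bdd (c := B) hχ.aestronglyMeasurable (ae_of_all _ hB)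
  have h2 := hFi.mul_bdd (c := B) hΨm.aestronglyMeasurable (ae_of_all _ hΨB)
  have h3 := hai.mul_bdd (c := B) (g := fun p => Ψ (p, T))
    (Measurable.aestronglyMeasurable (by fun_prop)) (ae_of_all _ fun p => hΨB _)
  rw [integral_prod _ h1, integral_prod _ h2, ← integral_add h2.integral_prod_left h3]
  refine integral_congr_ae ?_
  filter_upwards [ae_integrableOn_slice_of_memLp hF] with p hp
  exact integral_duhamel_mul_slice hT hp (h := fun t => χ (p, t)) (Ψ := fun t => Ψ (p, t))
    (by fun_prop) (fun t => hB _) (hΨ p)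

end Duhamel

/-! ### The flow of the transport field -/

section Flow

variable {d L : ℝ}

theorem continuous_coe_torus : Continuous (fun x : ℝ => (x : Torus d L)) :=
  AddCircle.continuous_mk' _

/-- Translation by `r` in the torus variable. -/
def translate (r : ℝ) : (Torus d L × ℝ) ≃ᵐ (Torus d L × ℝ) where
  toFun p := (p.1 + (r : Torus d L), p.2)
  invFun p := (p.1 - (r : Torus d L), p.2)
  left_inv p := by simp
  right_inv p := by simp
  measurable_toFun := Continuous.measurable (by simp only [Equiv.coe_fn_mk]; fun_prop)
  measurable_invFun := Continuous.measurable (by simp only [Equiv.coe_fn_symm_mk]; fun_prop)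

/-- The flow map `((x, z), t) ↦ ((x + u t, z), t)`. -/
def shear (u : ℝ) : ((Torus d L × ℝ) × ℝ) ≃ᵐ ((Torus d L × ℝ) × ℝ) where
  toFun q := ((q.1.1 + ((u * q.2 : ℝ) : Torus d L), q.1.2), q.2)
  invFun q := ((q.1.1 - ((u * q.2 : ℝ) : Torus d L), q.1.2), q.2)
  left_inv q := by simp
  right_inv q := by simp
  measurable_toFun := by
    have h : Continuous fun q : (Torus d L × ℝ) × ℝ => ((u * q.2 : ℝ) : Torus d L) :=
      continuous_coe_torus.comp (by fun_prop)
    exact Continuous.measurable (by simp only [Equiv.coe_fn_mk]; fun_prop)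
  measurable_invFun := by
    have h : Continuous fun q : (Torus d L × ℝ) × ℝ => ((u * q.2 : ℝ) : Torus d L) :=
      continuous_coe_torus.comp (by fun_prop)
    exact Continuous.measurable (by simp only [Equiv.coe_fn_symm_mk]; fun_prop)

theorem translate_apply (r : ℝ) (p : Torus d L × ℝ) :
    translate r p = (p.1 + (r : Torus d L), p.2) := rfl

theorem shear_apply (u : ℝ) (q : (Torus d L × ℝ) × ℝ) :
    shear u q = ((q.1.1 + ((u * q.2 : ℝ) : Torus d L), q.1.2), q.2) := rfl

/-- The solution of the backward transport equation obtained from Duhamel's formula. -/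
noncomputable def transportSol {E : Type*} [NormedAddCommGroup E] [NormedSpace ℝ E] (u c T : ℝ)
    (a : Torus d L × ℝ → E) (F : (Torus d L × ℝ) × ℝ → E) (q : (Torus d L × ℝ) × ℝ) : E :=
  duhamel c T (a ∘ translate (u * T)) (F ∘ shear u) ((shear u).symm q)

theorem transportSol_shear {E : Type*} [NormedAddCommGroup E] [NormedSpace ℝ E] (u c T : ℝ)
    (a : Torus d L × ℝ → E) (F : (Torus d L × ℝ) × ℝ → E) (q : (Torus d L × ℝ) × ℝ) :
    transportSol u c T a F (shear u q) =
      duhamel c T (a ∘ translate (u * T)) (F ∘ shear u) q := by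
  simp [transportSol]

variable [Fact (0 < d + 2 * L)]

theorem channelMeasure_eq_prod : channelMeasure d L =
    (volume : Measure (Torus d L)).prod (volume.restrict (Ioo (0 : ℝ) 1)) := by
  rw [channelMeasure, Measure.volume_eq_prod, ← Measure.prod_restrict, Measure.restrict_univ]

instance : IsFiniteMeasure (channelMeasure d L) := by
  rw [channelMeasure_eq_prod]; infer_instance

instance (T : ℝ) : IsFiniteMeasure (cylMeasure d L T) := by
  unfold cylMeasure; infer_instance

theorem measurePreserving_translate (r : ℝ) :
    MeasurePreserving (translate (d := d) (L := L) r) (channelMeasure d L)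
      (channelMeasure d L) := by
  rw [channelMeasure_eq_prod]
  exact (measurePreserving_add_right (volume : Measure (Torus d L)) (r : Torus d L)).prod
    (MeasurePreserving.id _)

/-- At each fixed time the flow is a translation, so it is a skew product over the identity in time.
The two swaps put time first, as a skew product requires. -/
theorem measurePreserving_shear (u T : ℝ) :
    MeasurePreserving (shear (d := d) (L := L) u) (cylMeasure d L T) (cylMeasure d L T) := by
  have h := MeasurePreserving.skew_product (MeasurePreserving.id (volume.restrict (Ioo 0 T)))
    (μc := channelMeasure d L) (μd := channelMeasure d L)
    (g := fun t p => translate (u * t) p) ?_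
    (ae_of_all _ fun t => (measurePreserving_translate (u * t)).map_eq)
  · exact (Measure.measurePreserving_swap.comp h).comp Measure.measurePreserving_swap
  · have : Continuous fun q : ℝ × (Torus d L × ℝ) => ((u * q.1 : ℝ) : Torus d L) :=
      continuous_coe_torus.comp (by fun_prop)
    refine Continuous.measurable ?_
    simp only [Function.uncurry_def, translate_apply]
    fun_prop

theorem measurePreserving_shear_symm (u T : ℝ) :
    MeasurePreserving (shear (d := d) (L := L) u).symm (cylMeasure d L T) (cylMeasure d L T) :=
  (measurePreserving_shear u T).symm _

theorem memLp_transportSol {E : Type*} [NormedAddCommGroup E] [NormedSpace ℝ E] {u c T : ℝ}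
    (hT : 0 ≤ T) {a : Torus d L × ℝ → E} {F : (Torus d L × ℝ) × ℝ → E}
    (ha : MemLp a 2 (channelMeasure d L)) (hF : MemLp F 2 (cylMeasure d L T)) :
    MemLp (transportSol u c T a F) 2 (cylMeasure d L T) :=
  (memLp_duhamel hT (ha.comp_measurePreserving (measurePreserving_translate _))
    (hF.comp_measurePreserving (measurePreserving_shear u T))).comp_measurePreserving
      (measurePreserving_shear_symm u T)

end Flow

/-! ### The observation window -/

section Observation

variable {d L : ℝ}

/-- The horizontal projection of the observation set. -/
def obsArc (d L : ℝ) : Set (Torus d L) :=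
  (fun x : ℝ => (x : Torus d L)) '' (Ioo (-L) 0 ∪ Ioc d (d + L))

/-- The quotient map is open, so only the endpoint `d + L` of the half-open interval has to be
treated apart. -/
theorem measurableSet_obsArc (hL : 0 < L) : MeasurableSet (obsArc d L) := by
  have h : Ioo (-L) 0 ∪ Ioc d (d + L) = (Ioo (-L) 0 ∪ Ioo d (d + L)) ∪ {d + L} := by
    rw [union_assoc, Ioo_union_right (by linarith)]
  rw [obsArc, h, image_union, image_singleton]
  exact ((QuotientAddGroup.isOpenMap_coe _ (isOpen_Ioo.union isOpen_Ioo)).measurableSet).union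
    (measurableSet_singleton _)

theorem obsMeasure_eq_restrict [Fact (0 < d + 2 * L)] (hL : 0 < L) (T : ℝ) :
    obsMeasure d L T = (cylMeasure d L T).restrict ((obsArc d L ×ˢ univ) ×ˢ univ) := by
  rw [obsMeasure, cylMeasure, ← Measure.prod_restrict, Measure.restrict_univ, channelMeasure,
    Measure.restrict_restrict ((measurableSet_obsArc hL).prod MeasurableSet.univ), prod_inter_prod,
    inter_univ, univ_inter]
  rfl

/-- The times of `[α, β]` at which the characteristic starting at `x` is observed. -/
def obsTimes (d L u α β : ℝ) (x : Torus d L) : Set ℝ :=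
  {t ∈ Icc α β | x + ((u * t : ℝ) : Torus d L) ∈ obsArc d L}

theorem measurableSet_obsTimes (hL : 0 < L) (u α β : ℝ) (x : Torus d L) :
    MeasurableSet (obsTimes d L u α β x) := by
  have h : Measurable fun t : ℝ => x + ((u * t : ℝ) : Torus d L) :=
    (continuous_const.add (continuous_coe_torus.comp (by fun_prop))).measurable
  exact measurableSet_Icc.inter (h (measurableSet_obsArc hL))

/-- A characteristic spends at most the time `d / u` outside of the observation set. -/
theorem le_volume_obsTimes [Fact (0 < d + 2 * L)] {u α β T : ℝ} (hd : 0 < d) (hu : 0 < u)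
    (hL : L = 3 * u * T) (hα : 0 < α) (hβ : β < T) (x : Torus d L) :
    ENNReal.ofReal (β - α - d / u) ≤ volume (obsTimes d L u α β x) := by
  -- With the representative in `(-2L, d]` and `0 < u t < u T = L / 3`, the lifted path stays in
  -- `(-2L, d + L)`. It can then be unobserved only while it is in `[0, d]`, a single time interval
  -- of length `d / u`.
  obtain ⟨y, hy, rfl⟩ : ∃ y ∈ Ioc (-(2 * L)) (-(2 * L) + (d + 2 * L)), (y : Torus d L) = x :=
    ⟨_, (AddCircle.equivIoc (d + 2 * L) (-(2 * L)) x).2, AddCircle.coe_equivIoc⟩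
  have hsub : Icc α β \ Icc (-y / u) ((d - y) / u) ⊆ obsTimes d L u α β (y : Torus d L) := by
    intro t ht
    refine ⟨ht.1, ?_⟩
    have ht0 : 0 < u * t := mul_pos hu (hα.trans_le ht.1.1)
    have htT : u * t < u * T := mul_lt_mul_of_pos_left (ht.1.2.trans_lt hβ) hu
    have hT0 : 0 < u * T := ht0.trans htT
    have hout : y + u * t < 0 ∨ d < y + u * t := by
      by_contra hc
      rw [not_or, not_lt, not_lt] at hc
      refine ht.2 ⟨?_, ?_⟩
      · rw [div_le_iff₀ hu]; linarith [hc.1, mul_comm u t]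
      · rw [le_div_iff₀ hu]; linarith [hc.2, mul_comm u t]
    rw [← AddCircle.coe_add]
    rcases hout with h | h
    · by_cases h2 : -L < y + u * t
      · exact ⟨y + u * t, Or.inl ⟨h2, h⟩, rfl⟩
      -- For positions in `(-2L, -L]`, one period carries the point into `(d, d + L]`.
      · refine ⟨y + u * t + (d + 2 * L), Or.inr ⟨?_, ?_⟩, ?_⟩
        · linarith [hy.1]
        · linarith
        · exact AddCircle.coe_add_period _ _
    · exact ⟨y + u * t, Or.inr ⟨h, by nlinarith [hy.2]⟩, rfl⟩
  calc ENNReal.ofReal (β - α - d / u)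
      = volume (Icc α β) - volume (Icc (-y / u) ((d - y) / u)) := by
        rw [Real.volume_Icc, Real.volume_Icc, ← ENNReal.ofReal_sub]
        · congr 1; ring
        · rw [← sub_div]; exact div_nonneg (by linarith) hu.le
    _ ≤ volume (Icc α β \ Icc (-y / u) ((d - y) / u)) := le_measure_sdiff
    _ ≤ _ := measure_mono hsub

end Observation

/-! ### The weights along characteristics -/

section Weights

variable {d L u T T₀ T₁ : ℝ}

theorem IsTimeWeight.antitoneOn {θ : ℝ → ℝ} (hθ : IsTimeWeight T T₀ T₁ θ) (hT₀ : 0 < T₀)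
    (hT : 2 * T₀ ≤ T - 2 * T₁) : AntitoneOn θ (Ioc 0 (T - 2 * T₁)) := by
  have h1 : AntitoneOn θ (Ioc 0 T₀) := by
    intro s hs t ht hst
    rw [hθ.eq_left s hs, hθ.eq_left t ht]
    exact one_div_le_one_div_of_le (pow_pos hs.1 2) (pow_le_pow_left₀ hs.1.le hst 2)
  have h3 : AntitoneOn θ (Icc (2 * T₀) (T - 2 * T₁)) := by
    intro s hs t ht _
    rw [hθ.eq_one s hs, hθ.eq_one t ht]
  have h12 := h1.union_right hθ.strictAntiOn.antitoneOn ⟨right_mem_Ioc.2 hT₀, fun x hx => hx.2⟩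
    ⟨left_mem_Icc.2 (by linarith), fun x hx => hx.1⟩
  rw [Ioc_union_Icc_eq_Ioc hT₀ (by linarith)] at h12
  have h := h12.union_right h3 ⟨right_mem_Ioc.2 (by linarith), fun x hx => hx.2⟩
    ⟨left_mem_Icc.2 hT, fun x hx => hx.1⟩
  rwa [Ioc_union_Icc_eq_Ioc (by linarith) hT] at h

theorem IsTimeWeight.monotoneOn {θ : ℝ → ℝ} (hθ : IsTimeWeight T T₀ T₁ θ) (hT₁ : 0 < T₁)
    (hT : 2 * T₀ ≤ T - 2 * T₁) : MonotoneOn θ (Ico (2 * T₀) T) := by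
  have h1 : MonotoneOn θ (Ico (T - T₁) T) := by
    intro s hs t ht hst
    rw [hθ.eq_right s hs, hθ.eq_right t ht]
    exact one_div_le_one_div_of_le (pow_pos (by linarith [ht.2]) 2)
      (pow_le_pow_left₀ (by linarith [ht.2]) (by linarith) 2)
  have h3 : MonotoneOn θ (Icc (2 * T₀) (T - 2 * T₁)) := by
    intro s hs t ht _
    rw [hθ.eq_one s hs, hθ.eq_one t ht]
  have h12 := h3.union_right hθ.strictMonoOn.monotoneOn
    ⟨right_mem_Icc.2 hT, fun x hx => hx.2⟩ ⟨left_mem_Icc.2 (by linarith), fun x hx => hx.1⟩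
  rw [Icc_union_Icc_eq_Icc hT (by linarith)] at h12
  have h := h12.union_right h1 ⟨right_mem_Icc.2 (by linarith), fun x hx => hx.2⟩
    ⟨left_mem_Ico.2 (by linarith), fun x hx => hx.1⟩
  rwa [Icc_union_Ico_eq_Ico (by linarith) (by linarith)] at h

/-- On whichever side of the plateau `t₀` lies, `θ` is monotone from `t₀` to `t₁` and ends at the
value `1`. -/
theorem IsTimeWeight.one_le_and_le {θ : ℝ → ℝ} (hθ : IsTimeWeight T T₀ T₁ θ) (hT₀ : 0 < T₀)
    (hT₁ : 0 < T₁) {t₀ t₁ t : ℝ} (h₀ : t₀ ∈ Ioo 0 T)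
    (h₁ : t₁ ∈ Icc (2 * T₀) (T - 2 * T₁)) (ht : t ∈ uIcc t₀ t₁) : 1 ≤ θ t ∧ θ t ≤ θ t₀ := by
  have hT := h₁.1.trans h₁.2
  have ha := hθ.antitoneOn hT₀ hT
  have hm := hθ.monotoneOn hT₁ hT
  rw [← hθ.eq_one t₁ h₁]
  rcases le_total t₀ t₁ with h | h
  · rw [uIcc_of_le h] at ht
    have e0 : t₀ ∈ Ioc 0 (T - 2 * T₁) := ⟨h₀.1, h.trans h₁.2⟩
    have e : t ∈ Ioc 0 (T - 2 * T₁) := ⟨h₀.1.trans_le ht.1, ht.2.trans h₁.2⟩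
    exact ⟨ha e ⟨by linarith [h₁.1], h₁.2⟩ ht.2, ha e0 e ht.1⟩
  · rw [uIcc_of_ge h] at ht
    have e0 : t₀ ∈ Ico (2 * T₀) T := ⟨h₁.1.trans h, h₀.2⟩
    have e : t ∈ Ico (2 * T₀) T := ⟨h₁.1.trans ht.1, ht.2.trans_lt h₀.2⟩
    exact ⟨hm ⟨h₁.1, by linarith [h₁.2]⟩ e ht.1, hm e e0 ht.2⟩

theorem IsSpaceWeight.continuous {η : Torus d L → ℝ} (hη : IsSpaceWeight u T η) :
    Continuous η :=
  isQuotientMap_quotient_mk'.continuous_iff.2 hη.contDiff.continuous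

theorem etaSup_nonneg (η : Torus d L → ℝ) : 0 ≤ etaSup u T η :=
  Real.iSup_nonneg fun _ => abs_nonneg _

theorem IsSpaceWeight.le_etaSup [Fact (0 < d + 2 * L)] {η : Torus d L → ℝ}
    (hη : IsSpaceWeight u T η) (hT : 0 ≤ T) (x : Torus d L) : η x ≤ etaSup u T η := by
  obtain ⟨K, hK⟩ := (isCompact_univ.image hη.continuous.abs).bddAbove
  have hb : BddAbove (range fun p : Torus d L × Icc (0 : ℝ) T => |etaZero u η p.1 p.2|) := by
    refine ⟨K, ?_⟩
    rintro _ ⟨p, rfl⟩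
    exact hK ⟨_, mem_univ _, rfl⟩
  -- The slice `t = 0`, where `η⁰` coincides with `η`, already gives the bound.
  have h := le_ciSup hb (x, ⟨0, left_mem_Icc.2 hT⟩)
  simp only [etaZero, mul_zero, AddCircle.coe_zero, sub_zero] at h
  exact (le_abs_self _).trans h

/-- The scalar weight `ξ^r e^{-sφ}`. -/
noncomputable def weight (u T : ℝ) (η : Torus d L → ℝ) (θ : ℝ → ℝ) (s lam r : ℝ)
    (q : (Torus d L × ℝ) × ℝ) : ℝ :=
  xi u T η θ lam q.1.1 q.2 ^ r * Real.exp (-s * phi u T η θ lam q.1.1 q.2)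

theorem enorm_weighted_sq {E : Type*} [NormedAddCommGroup E] [NormedSpace ℝ E]
    (η : Torus d L → ℝ) (θ : ℝ → ℝ) (s lam r : ℝ) (v : (Torus d L × ℝ) × ℝ → E)
    (q : (Torus d L × ℝ) × ℝ) : ‖weighted u T η θ s lam r v q‖ₑ ^ 2 =
      ‖weight u T η θ s lam r q‖ₑ ^ 2 * ‖v q‖ₑ ^ 2 := by
  rw [weighted, enorm_smul, mul_pow]; rfl

/-- The flow cancels the shift in `η⁰`, so only `θ` depends on time along a characteristic. -/
theorem weight_shear (η : Torus d L → ℝ) (θ : ℝ → ℝ) (s lam r : ℝ) (p : Torus d L × ℝ) (t : ℝ) :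
    weight u T η θ s lam r (shear u (p, t)) =
      (θ t * Real.exp (lam * (η p.1 + 4 * etaSup u T η))) ^ r *
        Real.exp (-s * (θ t * (Real.exp (6 * lam * etaSup u T η) -
          Real.exp (lam * (η p.1 + 4 * etaSup u T η))))) := by
  simp [weight, shear_apply, xi, phi, etaZero]

/-- Since `1 ≤ θ(t) b ≤ θ(t₀) b`, one has `(θ(t₀) b)^(-3/2) ≤ (θ(t₀) b)^(-1/2) ≤ (θ(t) b)^(-1/2)`.
The exponential factor is nonincreasing in `θ` because `A ≥ 0`, which follows from `η ≤ ‖η⁰‖_∞`. -/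
theorem enorm_weight_shear_le [Fact (0 < d + 2 * L)] {η : Torus d L → ℝ} {θ : ℝ → ℝ}
    (hη : IsSpaceWeight u T η) (hT : 0 ≤ T) {s lam : ℝ} (hs : 1 ≤ s) (hlam : 1 ≤ lam)
    (p : Torus d L × ℝ) {t₀ t : ℝ} (h1 : 1 ≤ θ t) (h2 : θ t ≤ θ t₀) :
    ‖weight u T η θ s lam (-(3 / 2)) (shear u (p, t₀))‖ₑ ≤
      ‖weight u T η θ s lam (-(1 / 2)) (shear u (p, t))‖ₑ := by
  have hM := etaSup_nonneg (u := u) (T := T) η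
  have hpos := hη.pos p.1
  have hle := hη.le_etaSup hT p.1
  rw [weight_shear, weight_shear]
  set b := Real.exp (lam * (η p.1 + 4 * etaSup u T η)) with hb
  set A := Real.exp (6 * lam * etaSup u T η) - b with hA
  have hb1 : 1 ≤ b := Real.one_le_exp (by positivity)
  have hA0 : 0 ≤ A := by
    rw [hA, hb, sub_nonneg]
    refine Real.exp_le_exp.2 ?_
    have : lam * (η p.1 + 4 * etaSup u T η) ≤ lam * (6 * etaSup u T η) :=
      mul_le_mul_of_nonneg_left (by linarith) (by linarith)
    linarith
  have hθb : 1 ≤ θ t * b := one_le_mul_of_one_le_of_one_le h1 hb1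
  have hθb' : θ t * b ≤ θ t₀ * b := mul_le_mul_of_nonneg_right h2 (by linarith)
  have h0 : 0 ≤ θ t * b := by linarith
  have h0' : 0 ≤ θ t₀ * b := by linarith
  rw [Real.enorm_eq_ofReal (by positivity), Real.enorm_eq_ofReal (by positivity)]
  refine ENNReal.ofReal_le_ofReal (mul_le_mul ?_ ?_ (Real.exp_nonneg _) (by positivity))
  · exact (Real.rpow_le_rpow_of_exponent_le (hθb.trans hθb') (by norm_num)).trans
      (Real.rpow_le_rpow_of_nonpos (by linarith) hθb' (by norm_num))
  · refine Real.exp_le_exp.2 ?_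
    have : θ t * A ≤ θ t₀ * A := mul_le_mul_of_nonneg_right h2 hA0
    nlinarith

theorem aemeasurable_weight [Fact (0 < d + 2 * L)] {η : Torus d L → ℝ} {θ : ℝ → ℝ}
    (hη : IsSpaceWeight u T η) (hθ : IsTimeWeight T T₀ T₁ θ) (s lam r : ℝ) :
    AEMeasurable (weight u T η θ s lam r) (cylMeasure d L T) := by
  have h1 : AEMeasurable (fun q : (Torus d L × ℝ) × ℝ => θ q.2) (cylMeasure d L T) :=
    AEMeasurable.comp_snd (f := θ) (hθ.contDiffOn.continuousOn.aemeasurable measurableSet_Ioo)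
  have h2 : Measurable (fun q : (Torus d L × ℝ) × ℝ => etaZero u η q.1.1 q.2) := by
    have h : Continuous fun q : (Torus d L × ℝ) × ℝ => ((u * q.2 : ℝ) : Torus d L) :=
      continuous_coe_torus.comp (by fun_prop)
    have := hη.continuous
    unfold etaZero
    exact Continuous.measurable (by fun_prop)
  have h3 : AEMeasurable (fun q : (Torus d L × ℝ) × ℝ =>
      Real.exp (lam * (etaZero u η q.1.1 q.2 + 4 * etaSup u T η))) (cylMeasure d L T) :=
    Measurable.aemeasurable (by fun_prop)
  exact ((h1.mul h3).pow_const r).mul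
    ((h1.mul (h3.const_sub _)).const_mul (-s)).exp

end Weights

/-! ### The weighted estimate for Duhamel's formula -/

section Estimate

variable {d L u c T T₀ T₁ : ℝ} [Fact (0 < d + 2 * L)]
  {E : Type*} [NormedAddCommGroup E] [NormedSpace ℝ E]

/-- The measure-preserving flow straightens the characteristics into the lines `{p} × (0,T)`; on
almost every one of them `measure_mul_duhamel_sq_le` applies with the observed times of the window
as `G`. -/
theorem ofReal_mul_lintegral_weighted_slice_le (hd : 0 < d) (hu : 0 < u) (hT : 0 < T)
    (hL : L = 3 * u * T) (hT₀ : 0 < T₀) (hT₁ : 0 < T₁)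
    {η : Torus d L → ℝ} (hη : IsSpaceWeight u T η) {θ : ℝ → ℝ} (hθ : IsTimeWeight T T₀ T₁ θ)
    {a : Torus d L × ℝ → E} {F : (Torus d L × ℝ) × ℝ → E}
    (ha : MemLp a 2 (channelMeasure d L)) (hF : MemLp F 2 (cylMeasure d L T))
    {s lam : ℝ} (hs : 1 ≤ s) (hlam : 1 ≤ lam) {t₀ : ℝ} (ht₀ : t₀ ∈ Ioo 0 T) :
    ENNReal.ofReal (T - 2 * T₁ - 2 * T₀ - d / u) *
      ∫⁻ p, ‖weighted u T η θ s lam (-(3 / 2)) (transportSol u c T a F) (p, t₀)‖ₑ ^ 2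
        ∂channelMeasure d L ≤
    energyConst c T * ((∫⁻ q, ‖weighted u T η θ s lam (-(1 / 2))
        (transportSol u c T a F) q‖ₑ ^ 2 ∂obsMeasure d L T) +
      ENNReal.ofReal T *
        ∫⁻ q, ‖weighted u T η θ s lam (-(1 / 2)) F q‖ₑ ^ 2 ∂cylMeasure d L T) := by
  have hL0 : 0 < L := by rw [hL]; positivity
  set R := transportSol u c T a F with hR
  set W := weight u T η θ s lam (-(1 / 2)) with hW
  set W₀ := weight u T η θ s lam (-(3 / 2)) with hW₀
  set D := duhamel c T (a ∘ translate (u * T)) (F ∘ shear u) with hD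
  have hRD : ∀ q, R (shear u q) = D q := transportSol_shear u c T a F
  have hFs : MemLp (F ∘ shear u) 2 (cylMeasure d L T) :=
    hF.comp_measurePreserving (measurePreserving_shear u T)
  have hDm : MemLp D 2 (cylMeasure d L T) :=
    memLp_duhamel hT.le (ha.comp_measurePreserving (measurePreserving_translate _)) hFs
  have hWm : AEMeasurable (fun q => ‖W (shear u q)‖ₑ ^ 2) (cylMeasure d L T) :=
    ((aemeasurable_weight hη hθ s lam _).comp_quasiMeasurePreserving
      (measurePreserving_shear u T).quasiMeasurePreserving).enorm.pow_const 2
  set O : Set ((Torus d L × ℝ) × ℝ) := (obsArc d L ×ˢ univ) ×ˢ univ with hO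
  have hOm : MeasurableSet O :=
    ((measurableSet_obsArc hL0).prod MeasurableSet.univ).prod MeasurableSet.univ
  have hOs : MeasurableSet (shear u ⁻¹' O) := (shear u).measurable hOm
  set I : (Torus d L × ℝ) × ℝ → ℝ≥0∞ := fun q => ‖W (shear u q)‖ₑ ^ 2 * ‖D q‖ₑ ^ 2 with hI
  have hIm : AEMeasurable I (cylMeasure d L T) := hWm.mul (hDm.1.enorm.pow_const 2)
  have hJm : AEMeasurable (fun q => ‖W (shear u q)‖ₑ ^ 2 * ‖(F ∘ shear u) q‖ₑ ^ 2)
      (cylMeasure d L T) := hWm.mul (hFs.1.enorm.pow_const 2)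
  have hobs : ∫⁻ q, ‖weighted u T η θ s lam (-(1 / 2)) R q‖ₑ ^ 2 ∂obsMeasure d L T =
      ∫⁻ p, (∫⁻ t in Ioo 0 T, (shear u ⁻¹' O).indicator I (p, t)) ∂channelMeasure d L := by
    rw [obsMeasure_eq_restrict hL0, ← lintegral_indicator hOm,
      (measurePreserving_shear u T).lintegral_map_equiv, cylMeasure,
      ← lintegral_prod _ (hIm.indicator hOs)]
    refine lintegral_congr fun q => ?_
    simp only [indicator, mem_preimage, enorm_weighted_sq, hRD, hI, hO]
    rfl
  have hsrc : ∫⁻ q, ‖weighted u T η θ s lam (-(1 / 2)) F q‖ₑ ^ 2 ∂cylMeasure d L T =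
      ∫⁻ p, (∫⁻ t in Ioo 0 T, ‖W (shear u (p, t))‖ₑ ^ 2 * ‖(F ∘ shear u) (p, t)‖ₑ ^ 2)
        ∂channelMeasure d L := by
    rw [(measurePreserving_shear u T).lintegral_map_equiv, cylMeasure, ← lintegral_prod _ hJm]
    exact lintegral_congr fun q => enorm_weighted_sq ..
  have hslice : ∫⁻ p, ‖weighted u T η θ s lam (-(3 / 2)) R (p, t₀)‖ₑ ^ 2 ∂channelMeasure d L =
      ∫⁻ p, ‖W₀ (shear u (p, t₀))‖ₑ ^ 2 * ‖D (p, t₀)‖ₑ ^ 2 ∂channelMeasure d L := by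
    rw [(measurePreserving_translate (u * t₀)).lintegral_map_equiv]
    refine lintegral_congr fun p => ?_
    rw [← hRD, ← enorm_weighted_sq]
    rfl
  rw [hobs, hsrc, hslice, ← lintegral_const_mul' _ _ ENNReal.ofReal_ne_top]
  rw [← lintegral_const_mul' _ _ ENNReal.ofReal_ne_top,
    ← lintegral_add_left' (hIm.indicator hOs).lintegral_prod_right',
    ← lintegral_const_mul' _ _ (energyConst_ne_top c T)]
  refine lintegral_mono_ae ?_
  filter_upwards [ae_integrableOn_slice_of_memLp hFs] with p hp
  have hG := measurableSet_obsTimes (d := d) hL0 u (2 * T₀) (T - 2 * T₁) p.1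
  have hGT : obsTimes d L u (2 * T₀) (T - 2 * T₁) p.1 ⊆ Ioo 0 T := fun t ht =>
    ⟨by linarith [ht.1.1], by linarith [ht.1.2]⟩
  have hmain := measure_mul_duhamel_sq_le (c := c) (a := a ∘ translate (u * T)) hp ht₀ hG hGT
    (‖W₀ (shear u (p, t₀))‖ₑ ^ 2) (fun t => ‖W (shear u (p, t))‖ₑ ^ 2) (by finiteness) (by
      intro t₁ ht₁ t ht
      obtain ⟨h1, h2⟩ := hθ.one_le_and_le hT₀ hT₁ ht₀ ht₁.1 ht
      exact pow_le_pow_left' (enorm_weight_shear_le hη hT.le hs hlam p h1 h2) 2)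
  refine (mul_le_mul_left (le_volume_obsTimes hd hu hL (by linarith) (by linarith) p.1) _).trans
    (hmain.trans ?_)
  refine mul_le_mul_right (add_le_add ?_ le_rfl) _
  rw [← lintegral_indicator hG, ← lintegral_indicator measurableSet_Ioo]
  refine lintegral_mono fun t => ?_
  by_cases ht : t ∈ obsTimes d L u (2 * T₀) (T - 2 * T₁) p.1
  · have hmem : (p, t) ∈ shear u ⁻¹' O := ⟨⟨ht.2, mem_univ _⟩, mem_univ _⟩
    rw [indicator_of_mem ht, indicator_of_mem (hGT ht), indicator_of_mem hmem]
  · rw [indicator_of_notMem ht]; exact zero_le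

/-- The Carleman estimate for solutions given by Duhamel's formula. -/
theorem exists_const_transportSol_le (c : ℝ) (hd : 0 < d) (hu : 0 < u) (hT : 0 < T)
    (hL : L = 3 * u * T) (hT₀ : 0 < T₀) (hT₁ : 0 < T₁)
    (hT₀₁ : 2 * T₀ + 2 * T₁ < T - d / u)
    {η : Torus d L → ℝ} (hη : IsSpaceWeight u T η) {θ : ℝ → ℝ} (hθ : IsTimeWeight T T₀ T₁ θ) :
    ∃ C : ℝ, 0 < C ∧ ∀ (a : Torus d L × ℝ → E) (F : (Torus d L × ℝ) × ℝ → E) (s lam : ℝ),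
      1 ≤ s → 1 ≤ lam → MemLp a 2 (channelMeasure d L) → MemLp F 2 (cylMeasure d L T) →
      normLinftyL2 T (weighted u T η θ s lam (-(3 / 2)) (transportSol u c T a F)) ^ 2 ≤
        ENNReal.ofReal C *
          (eLpNorm (weighted u T η θ s lam (-(1 / 2)) F) 2 (cylMeasure d L T) ^ 2 +
            ENNReal.ofReal (s * lam) *
              eLpNorm (weighted u T η θ s lam (-(1 / 2)) (transportSol u c T a F)) 2
                (obsMeasure d L T) ^ 2) := by
  -- The guaranteed observation time: the length of the window minus the crossing time.
  set δ := T - 2 * T₁ - 2 * T₀ - d / u with hδ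
  have hδ0 : 0 < δ := by linarith
  have hδ' : ENNReal.ofReal δ ≠ 0 := by simpa using hδ0
  set K : ℝ≥0∞ := (ENNReal.ofReal δ)⁻¹ * (energyConst c T * (1 + ENNReal.ofReal T)) with hK
  have hKtop : K ≠ ⊤ := by
    have := energyConst_ne_top c T
    have := ENNReal.inv_ne_top.2 hδ'
    finiteness
  -- Adding `1` makes the constant visibly positive.
  refine ⟨K.toReal + 1, by positivity, fun a F s lam hs hlam ha hF => ?_⟩
  have hKle : K ≤ ENNReal.ofReal (K.toReal + 1) := by
    conv_lhs => rw [← ENNReal.ofReal_toReal hKtop]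
    exact ENNReal.ofReal_le_ofReal (by linarith)
  have hsl : 1 ≤ ENNReal.ofReal (s * lam) := by
    rw [ENNReal.one_le_ofReal]; exact one_le_mul_of_one_le_of_one_le hs hlam
  rw [eLpNorm_two_sq, eLpNorm_two_sq]
  set X := ∫⁻ q, ‖weighted u T η θ s lam (-(1 / 2)) F q‖ₑ ^ 2 ∂cylMeasure d L T with hX
  set Y := ∫⁻ q, ‖weighted u T η θ s lam (-(1 / 2)) (transportSol u c T a F) q‖ₑ ^ 2
    ∂obsMeasure d L T with hY
  set Z := ENNReal.ofReal (K.toReal + 1) * (X + ENNReal.ofReal (s * lam) * Y) with hZ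
  -- The essential supremum is taken of the norm, not of its square, so the bound is stated with a
  -- square root. It holds at every `t₀`.
  have hslice : ∀ t₀ ∈ Ioo 0 T,
      eLpNorm (fun p => weighted u T η θ s lam (-(3 / 2)) (transportSol u c T a F) (p, t₀)) 2
        (channelMeasure d L) ≤
      Z ^ (1 / 2 : ℝ) := by
    intro t₀ ht₀
    have hmain := ofReal_mul_lintegral_weighted_slice_le (c := c) hd hu hT hL hT₀ hT₁ hη hθ ha hF
      hs hlam ht₀
    rw [← eLpNorm_two_sq] at hmain
    set x := eLpNorm (fun p => weighted u T η θ s lam (-(3 / 2)) (transportSol u c T a F) (p, t₀))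
      2 (channelMeasure d L) with hx
    have hsq : x ^ 2 ≤ Z := by
      calc x ^ 2 = (ENNReal.ofReal δ)⁻¹ * (ENNReal.ofReal δ * x ^ 2) := by
            rw [← mul_assoc, ENNReal.inv_mul_cancel hδ' ENNReal.ofReal_ne_top, one_mul]
        _ ≤ (ENNReal.ofReal δ)⁻¹ * (energyConst c T * (Y + ENNReal.ofReal T * X)) := by
            gcongr
        _ ≤ (ENNReal.ofReal δ)⁻¹ * (energyConst c T *
            ((1 + ENNReal.ofReal T) * (1 * Y) + (1 + ENNReal.ofReal T) * X)) := by
            gcongr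
            · rw [one_mul]; exact le_mul_of_one_le_left' le_self_add
            · exact le_add_self
        _ = K * (X + 1 * Y) := by rw [hK]; ring
        _ ≤ Z := by rw [hZ]; gcongr
    calc x = (x ^ 2) ^ (1 / 2 : ℝ) := by
          rw [← ENNReal.rpow_natCast, ← ENNReal.rpow_mul]; norm_num
      _ ≤ Z ^ (1 / 2 : ℝ) := ENNReal.rpow_le_rpow hsq (by norm_num)
  calc normLinftyL2 T (weighted u T η θ s lam (-(3 / 2)) (transportSol u c T a F)) ^ 2
      ≤ (Z ^ (1 / 2 : ℝ)) ^ 2 := by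
        refine pow_le_pow_left' (essSup_le_of_ae_le _ ?_) 2
        filter_upwards [ae_restrict_mem measurableSet_Ioo] with t ht using hslice t ht
    _ = Z := by rw [← ENNReal.rpow_natCast, ← ENNReal.rpow_mul]; norm_num

end Estimate

/-! ### Test functions on the cylinder -/

section TestFunctions

variable {d L : ℝ}

/-- The covering map of the space-time cylinder. -/
def cover (d L : ℝ) (q : (ℝ × ℝ) × ℝ) : (Torus d L × ℝ) × ℝ :=
  (((q.1.1 : Torus d L), q.1.2), q.2)

theorem isOpenQuotientMap_cover : IsOpenQuotientMap (cover d L) :=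
  (QuotientAddGroup.isOpenQuotientMap_mk.prodMap IsOpenQuotientMap.id).prodMap
    IsOpenQuotientMap.id

theorem continuous_cover : Continuous (cover d L) :=
  isOpenQuotientMap_cover.continuous

theorem SmoothSpaceTime.continuous {χ : (Torus d L × ℝ) × ℝ → ℝ} (hχ : SmoothSpaceTime χ) :
    Continuous χ :=
  isOpenQuotientMap_cover.continuous_comp_iff.1 (ContDiff.continuous hχ)

variable [Fact (0 < d + 2 * L)]

/-- The fundamental domain of the cylinder. -/
def fundDomain (d L T : ℝ) : Set ((ℝ × ℝ) × ℝ) :=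
  (Ioo 0 (d + 2 * L) ×ˢ Ioo 0 1) ×ˢ Ioo 0 T

theorem measurePreserving_cover (T : ℝ) :
    MeasurePreserving (cover d L) (volume.restrict (fundDomain d L T)) (cylMeasure d L T) := by
  have h := (AddCircle.measurePreserving_mk (d + 2 * L) 0)
  rw [zero_add, ← restrict_Ioo_eq_restrict_Ioc] at h
  have h2 := (h.prod (MeasurePreserving.id (volume.restrict (Ioo (0 : ℝ) 1)))).prod
    (MeasurePreserving.id (volume.restrict (Ioo (0 : ℝ) T)))
  rw [fundDomain, Measure.volume_eq_prod, ← Measure.prod_restrict, Measure.volume_eq_prod,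
    ← Measure.prod_restrict, cylMeasure, channelMeasure_eq_prod]
  exact h2

/-- The periodic extension of a function supported in the fundamental domain. -/
noncomputable def periodize (g : (ℝ × ℝ) × ℝ → ℝ) (q : (Torus d L × ℝ) × ℝ) : ℝ :=
  g (((AddCircle.equivIoc (d + 2 * L) 0 q.1.1 : ℝ), q.1.2), q.2)

theorem periodize_cover {T : ℝ} {g : (ℝ × ℝ) × ℝ → ℝ} {q : (ℝ × ℝ) × ℝ}
    (hq : q ∈ fundDomain d L T) : periodize g (cover d L q) = g q := by
  have hx : q.1.1 ∈ Ioc 0 (0 + (d + 2 * L)) := ⟨hq.1.1.1, by linarith [hq.1.1.2]⟩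
  simp only [periodize, cover, AddCircle.equivIoc_coe_of_mem hx]

theorem smoothSpaceTime_periodize {T : ℝ} {g : (ℝ × ℝ) × ℝ → ℝ} (hg : ContDiff ℝ ∞ g)
    (hsupp : tsupport g ⊆ fundDomain d L T) :
    SmoothSpaceTime (periodize (d := d) (L := L) g) := by
  have hp : 0 < d + 2 * L := Fact.out
  have hzero : ∀ x z t : ℝ, x ∉ Ioo 0 (d + 2 * L) → g ((x, z), t) = 0 := by
    intro x z t hx
    exact image_eq_zero_of_notMem_tsupport fun h => hx (hsupp h).1.1
  rw [SmoothSpaceTime, contDiff_iff_contDiffAt]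
  intro q₀
  set n := toIocDiv hp 0 q₀.1.1 with hn
  set r : ℝ := n * (d + 2 * L) with hr
  have hmem : q₀.1.1 - r ∈ Ioc 0 (d + 2 * L) := by
    have := sub_toIocDiv_zsmul_mem_Ioc hp 0 q₀.1.1
    rwa [zero_add, zsmul_eq_mul] at this
  have hcoe : ∀ x : ℝ, ((x - r : ℝ) : Torus d L) = x := by
    intro x
    rw [AddCircle.coe_sub, sub_eq_self, AddCircle.coe_eq_zero_iff]
    exact ⟨n, by rw [zsmul_eq_mul]⟩
  -- The chosen representative jumps at the seam `x - r = d + 2L`. On the neighbourhood `0 < x - r <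
  -- 2(d + 2L)` of the point, the periodization equals this sum of two translates, which is smooth
  -- across the seam.
  have hloc : ContDiff ℝ ∞ fun q : (ℝ × ℝ) × ℝ =>
      g ((q.1.1 - r, q.1.2), q.2) + g ((q.1.1 - r - (d + 2 * L), q.1.2), q.2) := by
    fun_prop
  refine hloc.contDiffAt.congr_of_eventuallyEq ?_
  have hopen : IsOpen {q : (ℝ × ℝ) × ℝ | q.1.1 - r ∈ Ioo 0 (2 * (d + 2 * L))} :=
    isOpen_Ioo.preimage (by fun_prop)
  filter_upwards [hopen.mem_nhds ⟨hmem.1, by linarith [hmem.2]⟩] with q hq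
  rcases le_or_gt (q.1.1 - r) (d + 2 * L) with h | h
  · have hx : q.1.1 - r ∈ Ioc 0 (0 + (d + 2 * L)) := ⟨hq.1, by linarith⟩
    rw [hzero (q.1.1 - r - (d + 2 * L)) _ _ (fun h' => by linarith [h'.1]), add_zero, periodize,
      ← hcoe q.1.1, AddCircle.equivIoc_coe_of_mem hx]
  · have hx : q.1.1 - r - (d + 2 * L) ∈ Ioc 0 (0 + (d + 2 * L)) :=
      ⟨by linarith, by linarith [hq.2]⟩
    have he : (q.1.1 : Torus d L) = ((q.1.1 - r - (d + 2 * L) : ℝ) : Torus d L) := by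
      rw [← AddCircle.coe_add_period _ (q.1.1 - r - (d + 2 * L)), sub_add_cancel, hcoe]
    rw [hzero (q.1.1 - r) _ _ (fun h' => by linarith [h'.2]), zero_add, periodize, he,
      AddCircle.equivIoc_coe_of_mem hx]

theorem tsupport_periodize_subset {g : (ℝ × ℝ) × ℝ → ℝ} (hg : HasCompactSupport g) :
    tsupport (periodize (d := d) (L := L) g) ⊆ cover d L '' tsupport g := by
  refine closure_minimal ?_ (hg.image continuous_cover).isClosed
  intro q hq
  exact ⟨(((AddCircle.equivIoc (d + 2 * L) 0 q.1.1 : ℝ), q.1.2), q.2), subset_tsupport _ hq, by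
    simp [cover, AddCircle.coe_equivIoc]⟩

/-- The fundamental lemma of the calculus of variations on the cylinder. -/
theorem ae_eq_zero_of_forall_test {T : ℝ} {w : (Torus d L × ℝ) × ℝ → ℝ}
    (hw : Integrable w (cylMeasure d L T))
    (h : ∀ χ : (Torus d L × ℝ) × ℝ → ℝ, SmoothSpaceTime χ → HasCompactSupport χ →
      tsupport χ ⊆ (univ ×ˢ Ioo (0 : ℝ) 1) ×ˢ Ioo (0 : ℝ) T →
      ∫ q, w q * χ q ∂(cylMeasure d L T) = 0) :
    w =ᵐ[cylMeasure d L T] 0 := by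
  have hcov := measurePreserving_cover (d := d) (L := L) T
  have hU : IsOpen (fundDomain d L T) := (isOpen_Ioo.prod isOpen_Ioo).prod isOpen_Ioo
  have hwc : Integrable (w ∘ cover d L) (volume.restrict (fundDomain d L T)) :=
    hcov.integrable_comp_of_integrable hw
  have hae := hU.ae_eq_zero_of_integral_contDiff_smul_eq_zero
    (IntegrableOn.locallyIntegrableOn hwc) (fun g hg hgc hgs => by
      have hsub : tsupport (periodize (d := d) (L := L) g) ⊆
          (univ ×ˢ Ioo (0 : ℝ) 1) ×ˢ Ioo (0 : ℝ) T := by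
        refine (tsupport_periodize_subset hgc).trans ?_
        rintro _ ⟨q, hq, rfl⟩
        exact ⟨⟨mem_univ _, (hgs hq).1.2⟩, (hgs hq).2⟩
      have hcpt : HasCompactSupport (periodize (d := d) (L := L) g) :=
        (hgc.image continuous_cover).of_isClosed_subset (isClosed_tsupport _)
          (tsupport_periodize_subset hgc)
      have hsm := smoothSpaceTime_periodize (d := d) (L := L) hg hgs
      have h0 := h _ hsm hcpt hsub
      rw [← hcov.map_eq, integral_map hcov.aemeasurable (by
        rw [hcov.map_eq]
        exact hw.aestronglyMeasurable.mul hsm.continuous.aestronglyMeasurable)] at h0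
      rw [← setIntegral_eq_integral_of_forall_compl_eq_zero (s := fundDomain d L T), ← h0]
      · refine setIntegral_congr_fun hU.measurableSet fun q hq => ?_
        simp only [periodize_cover hq, smul_eq_mul, Function.comp_apply, mul_comm]
      · intro q hq
        rw [image_eq_zero_of_notMem_tsupport fun h' => hq (hgs h'), zero_smul])
  have hz : ∫⁻ q, ‖w q‖ₑ ∂cylMeasure d L T = 0 := by
    rw [← hcov.map_eq, lintegral_map' (by rw [hcov.map_eq]; exact hw.1.enorm) hcov.aemeasurable,
      setLIntegral_congr_fun_ae (g := fun _ => 0) hU.measurableSet, lintegral_zero]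
    filter_upwards [hae] with q hq hqU
    have := hq hqU
    simpa using this
  rw [lintegral_eq_zero_iff' hw.1.enorm] at hz
  filter_upwards [hz] with q hq
  simpa using hq

end TestFunctions

/-! ### Derivatives of test functions -/

section Derivatives

variable {d L : ℝ}

theorem SmoothSpaceTime.contDiff_cover {ψ : (Torus d L × ℝ) × ℝ → ℝ} (hψ : SmoothSpaceTime ψ) :
    ContDiff ℝ ∞ (ψ ∘ cover d L) := hψ

theorem SmoothSpaceTime.hasFDerivAt {ψ : (Torus d L × ℝ) × ℝ → ℝ} (hψ : SmoothSpaceTime ψ)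
    (q : (ℝ × ℝ) × ℝ) :
    HasFDerivAt (ψ ∘ cover d L) (fderiv ℝ (ψ ∘ cover d L) q) q :=
  (hψ.contDiff_cover.differentiable (by simp) q).hasFDerivAt

theorem cylDx_cover {ψ : (Torus d L × ℝ) × ℝ → ℝ} (hψ : SmoothSpaceTime ψ) (q : (ℝ × ℝ) × ℝ) :
    cylDx ψ (cover d L q) = fderiv ℝ (ψ ∘ cover d L) q ((1, 0), 0) := by
  have hc : HasDerivAt (fun h : ℝ => ((q.1.1 + h, q.1.2), q.2)) (((1 : ℝ), (0 : ℝ)), (0 : ℝ)) 0 :=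
    (((hasDerivAt_id (0 : ℝ)).const_add q.1.1).prodMk (hasDerivAt_const _ _)).prodMk
      (hasDerivAt_const _ _)
  have h := HasFDerivAt.comp_hasDerivAt_of_eq (0 : ℝ) (hψ.hasFDerivAt q) hc (by simp)
  rw [← h.deriv, cylDx, spaceDx]
  congr 1

theorem cylDz_cover {ψ : (Torus d L × ℝ) × ℝ → ℝ} (hψ : SmoothSpaceTime ψ) (q : (ℝ × ℝ) × ℝ) :
    cylDz ψ (cover d L q) = fderiv ℝ (ψ ∘ cover d L) q ((0, 1), 0) := by
  have hc : HasDerivAt (fun h : ℝ => ((q.1.1, h), q.2)) (((0 : ℝ), (1 : ℝ)), (0 : ℝ)) q.1.2 :=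
    ((hasDerivAt_const _ _).prodMk (hasDerivAt_id _)).prodMk (hasDerivAt_const _ _)
  have h := HasFDerivAt.comp_hasDerivAt_of_eq q.1.2 (hψ.hasFDerivAt q) hc rfl
  rw [← h.deriv]
  rfl

theorem timeDt_cover {ψ : (Torus d L × ℝ) × ℝ → ℝ} (hψ : SmoothSpaceTime ψ) (q : (ℝ × ℝ) × ℝ) :
    timeDt ψ (cover d L q) = fderiv ℝ (ψ ∘ cover d L) q ((0, 0), 1) := by
  have hc : HasDerivAt (fun h : ℝ => (q.1, h)) ((0 : ℝ × ℝ), (1 : ℝ)) q.2 :=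
    (hasDerivAt_const _ _).prodMk (hasDerivAt_id _)
  have h := HasFDerivAt.comp_hasDerivAt_of_eq q.2 (hψ.hasFDerivAt q) hc rfl
  rw [← Prod.zero_eq_mk, ← h.deriv]
  rfl

theorem timeDt_add_mul_cylDx_cover {ψ : (Torus d L × ℝ) × ℝ → ℝ} (hψ : SmoothSpaceTime ψ) (u : ℝ)
    (q : (ℝ × ℝ) × ℝ) : timeDt ψ (cover d L q) + u * cylDx ψ (cover d L q) =
      fderiv ℝ (ψ ∘ cover d L) q ((u, 0), 1) := by
  rw [timeDt_cover hψ, cylDx_cover hψ, ← smul_eq_mul, ← map_smul, ← map_add]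
  simp

/-- `ψ'` is the derivative of `ψ` in the direction `v`, read on the universal cover. -/
def IsDirDeriv (v : (ℝ × ℝ) × ℝ) (ψ ψ' : (Torus d L × ℝ) × ℝ → ℝ) : Prop :=
  ∀ q, ψ' (cover d L q) = fderiv ℝ (ψ ∘ cover d L) q v

theorem IsDirDeriv.smooth {v : (ℝ × ℝ) × ℝ} {ψ ψ' : (Torus d L × ℝ) × ℝ → ℝ}
    (h : IsDirDeriv v ψ ψ') (hψ : SmoothSpaceTime ψ) : SmoothSpaceTime ψ' := by
  have h1 : ContDiff ℝ ∞ fun q => fderiv ℝ (ψ ∘ cover d L) q v :=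
    (hψ.contDiff_cover.fderiv_right (m := ∞) (by simp)).clm_apply contDiff_const
  have h2 : ψ' ∘ cover d L = fun q => fderiv ℝ (ψ ∘ cover d L) q v := funext h
  rw [← h2] at h1
  exact h1

theorem IsDirDeriv.tsupport_subset {v : (ℝ × ℝ) × ℝ} {ψ ψ' : (Torus d L × ℝ) × ℝ → ℝ}
    (h : IsDirDeriv v ψ ψ') : tsupport ψ' ⊆ tsupport ψ := by
  refine closure_minimal ?_ (isClosed_tsupport _)
  intro q hq
  obtain ⟨q, rfl⟩ := isOpenQuotientMap_cover.surjective q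
  by_contra hn
  refine hq ?_
  have h0 : ψ ∘ cover d L =ᶠ[nhds q] fun _ => 0 :=
    continuous_cover.continuousAt.eventually (notMem_tsupport_iff_eventuallyEq.1 hn)
  rw [h, h0.fderiv_eq]
  simp

/-- Directional derivatives commute with the transport operator. -/
theorem IsDirDeriv.transport_eq {v : (ℝ × ℝ) × ℝ} {u c T : ℝ}
    {ψ ψ' χ χ' : (Torus d L × ℝ) × ℝ → ℝ} (h : IsDirDeriv v ψ ψ') (h' : IsDirDeriv v χ χ')
    (hψ : SmoothSpaceTime ψ)
    (hL : ∀ q, q.2 ∈ Ioo 0 T → timeDt ψ q + u * cylDx ψ q + c * ψ q = χ q)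
    (q : (Torus d L × ℝ) × ℝ) (hq : q.2 ∈ Ioo 0 T) :
    timeDt ψ' q + u * cylDx ψ' q + c * ψ' q = χ' q := by
  obtain ⟨q, rfl⟩ := isOpenQuotientMap_cover.surjective q
  have hopen : IsOpen {q : (ℝ × ℝ) × ℝ | q.2 ∈ Ioo 0 T} := isOpen_Ioo.preimage continuous_snd
  have hev : χ ∘ cover d L =ᶠ[nhds q]
      fun q => fderiv ℝ (ψ ∘ cover d L) q ((u, 0), 1) + c * (ψ ∘ cover d L) q := by
    filter_upwards [hopen.mem_nhds hq] with y hy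
    rw [Function.comp_apply, ← hL _ hy, timeDt_add_mul_cylDx_cover hψ]
    rfl
  have hd : DifferentiableAt ℝ (fderiv ℝ (ψ ∘ cover d L)) q :=
    ((hψ.contDiff_cover.fderiv_right (m := ∞) (by simp)).differentiable (by simp)) q
  -- Commutation of the two directional derivatives is the symmetry of the second derivative.
  have hsymm : IsSymmSndFDerivAt ℝ (ψ ∘ cover d L) q :=
    hψ.contDiff_cover.contDiffAt.isSymmSndFDerivAt (by
      rw [minSmoothness_of_isRCLikeNormedField]; exact WithTop.coe_le_coe.2 (le_top : (2 : ℕ∞) ≤ ⊤))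
  have hψ' : ψ' ∘ cover d L = fun q => fderiv ℝ (ψ ∘ cover d L) q v := funext h
  rw [timeDt_add_mul_cylDx_cover (h.smooth hψ), h', h, hev.fderiv_eq, hψ',
    fderiv_fun_add (hd.clm_apply (differentiableAt_const _))
      ((hψ.hasFDerivAt q).differentiableAt.const_mul c),
    fderiv_clm_apply hd (differentiableAt_const _), fderiv_clm_apply hd (differentiableAt_const _),
    fderiv_const_mul (hψ.hasFDerivAt q).differentiableAt]
  simp [hsymm.eq v ((u, 0), 1)]

theorem isDirDeriv_cylDx {ψ : (Torus d L × ℝ) × ℝ → ℝ} (hψ : SmoothSpaceTime ψ) :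
    IsDirDeriv ((1, 0), 0) ψ (cylDx ψ) := cylDx_cover hψ

theorem isDirDeriv_cylDz {ψ : (Torus d L × ℝ) × ℝ → ℝ} (hψ : SmoothSpaceTime ψ) :
    IsDirDeriv ((0, 1), 0) ψ (cylDz ψ) := cylDz_cover hψ

end Derivatives

/-! ### The adjoint transport equation -/

section Adjoint

variable {d L : ℝ}

/-- The solution of `∂ₜψ + u ∂ₓψ + c ψ = χ` vanishing for small times, cut off after time `T`. -/
noncomputable def adjointSol (u c T : ℝ) (χ : (Torus d L × ℝ) × ℝ → ℝ)
    (q : (Torus d L × ℝ) × ℝ) : ℝ :=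
  -- This factor is `1` for times up to `T + 1` and `0` from `T + 2` on: it gives compact support
  -- without affecting the equation on `(0,T)` or the value at `T`.
  Real.smoothTransition (T + 2 - q.2) *
    ∫ r, (Ici (0 : ℝ)).indicator (fun r => Real.exp (-c * r)) r *
      χ ((q.1.1 - ((u * r : ℝ) : Torus d L), q.1.2), q.2 - r)

variable {u c T : ℝ} {χ : (Torus d L × ℝ) × ℝ → ℝ}

/-- In the coordinates `(x - u t, z, t)` the integral is a convolution in time of the locally
integrable kernel `1_{r ≥ 0} e^{-cr}` with a smooth function depending on parameters and supported
in `[0,T]` in time. -/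
theorem smoothSpaceTime_adjointSol (hχ : SmoothSpaceTime χ)
    (hsupp : tsupport χ ⊆ (univ ×ˢ Ioo (0 : ℝ) 1) ×ˢ Ioo (0 : ℝ) T) :
    SmoothSpaceTime (adjointSol u c T χ) := by
  have hf : LocallyIntegrable ((Ici (0 : ℝ)).indicator fun r => Real.exp (-c * r)) :=
    (Continuous.locallyIntegrable (by fun_prop)).indicator measurableSet_Ici
  have hg : ContDiff ℝ ∞ fun q : (ℝ × ℝ) × ℝ =>
      χ (cover d L ((q.1.1 + u * q.2, q.1.2), q.2)) :=
    hχ.contDiff_cover.comp (g := χ ∘ cover d L) (by fun_prop)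
  have hconv := contDiffOn_convolution_right_with_param (𝕜 := ℝ) (μ := volume) (n := ⊤)
    (ContinuousLinearMap.mul ℝ ℝ)
    (g := fun (p : ℝ × ℝ) (τ : ℝ) => χ (cover d L ((p.1 + u * τ, p.2), τ)))
    (s := univ) (k := Icc 0 T) isOpen_univ isCompact_Icc
    (fun p τ _ hτ => image_eq_zero_of_notMem_tsupport fun h =>
      hτ (Ioo_subset_Icc_self (hsupp h).2)) hf hg.contDiffOn
  rw [univ_prod_univ, contDiffOn_univ] at hconv
  have hcomp : ContDiff ℝ ∞ fun q : (ℝ × ℝ) × ℝ => ∫ r,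
      (Ici (0 : ℝ)).indicator (fun r => Real.exp (-c * r)) r *
        χ (cover d L ((q.1.1 - u * q.2 + u * (q.2 - r), q.1.2), q.2 - r)) :=
    hconv.comp (f := fun q : (ℝ × ℝ) × ℝ => ((q.1.1 - u * q.2, q.1.2), q.2)) (by fun_prop)
  have hκ : ContDiff ℝ ∞ fun q : (ℝ × ℝ) × ℝ => Real.smoothTransition (T + 2 - q.2) :=
    Real.smoothTransition.contDiff.comp (by fun_prop)
  have key : ContDiff ℝ ∞ fun q : (ℝ × ℝ) × ℝ => Real.smoothTransition (T + 2 - q.2) * ∫ r,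
      (Ici (0 : ℝ)).indicator (fun r => Real.exp (-c * r)) r *
        χ (cover d L ((q.1.1 - u * q.2 + u * (q.2 - r), q.1.2), q.2 - r)) := hκ.mul hcomp
  have hshift : ∀ x t r : ℝ, ((x - u * t + u * (t - r) : ℝ) : Torus d L) =
      (x : Torus d L) - ((u * r : ℝ) : Torus d L) := by
    intro x t r
    rw [← AddCircle.coe_sub]; congr 1; ring
  simp only [cover, hshift] at key
  exact key

/-- Substitute `τ = t - r`; the range `r > t` contributes nothing because `χ` vanishes at negative
times. -/
theorem adjointSol_shear (hsupp : tsupport χ ⊆ (univ ×ˢ Ioo (0 : ℝ) 1) ×ˢ Ioo (0 : ℝ) T)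
    (p : Torus d L × ℝ) {t : ℝ} (ht : t ∈ Icc 0 T) :
    adjointSol u c T χ (shear u (p, t)) =
      ∫ τ in 0..t, Real.exp (-c * (t - τ)) * χ (shear u (p, τ)) := by
  have hterm : ∀ r, χ (((shear u (p, t)).1.1 - ((u * r : ℝ) : Torus d L), (shear u (p, t)).1.2),
      (shear u (p, t)).2 - r) = χ (shear u (p, t - r)) := by
    intro r
    simp only [shear_apply]
    rw [add_sub_assoc, ← AddCircle.coe_sub, ← mul_sub]
  rw [adjointSol, Real.smoothTransition.one_of_one_le (by simp [shear_apply]; linarith [ht.2]),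
    one_mul]
  have hind : ∀ r, (Ici (0 : ℝ)).indicator (fun r => Real.exp (-c * r)) r *
      χ (shear u (p, t - r)) =
      (Ici (0 : ℝ)).indicator (fun r => Real.exp (-c * r) * χ (shear u (p, t - r))) r :=
    fun r => by simp only [indicator]; split_ifs <;> simp
  simp only [hterm, hind]
  rw [integral_indicator measurableSet_Ici,
    setIntegral_eq_of_subset_of_forall_sdiff_eq_zero measurableSet_Ici
      (Icc_subset_Ici_self : Icc 0 t ⊆ Ici 0), integral_Icc_eq_integral_Ioc,
    ← intervalIntegral.integral_of_le ht.1]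
  · have h := intervalIntegral.integral_comp_sub_left (a := 0) (b := t)
      (fun τ => Real.exp (-c * (t - τ)) * χ (shear u (p, τ))) t
    simp only [sub_sub_cancel, sub_self, sub_zero] at h
    exact h
  · intro r hr
    have hr' : t < r := by
      by_contra hc
      exact hr.2 ⟨hr.1, not_lt.1 hc⟩
    have h0 : χ (shear u (p, t - r)) = 0 := image_eq_zero_of_notMem_tsupport fun h => by
      have h2 : 0 < t - r := (hsupp h).2.1
      linarith
    rw [h0, mul_zero]

/-- On a characteristic, `∂ₜ + u ∂ₓ` is the ordinary derivative in `t`, and the solution is `e^{-ct}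
∫₀ᵗ e^{cτ} χ dτ`, which is differentiated directly. -/
theorem adjointSol_eq (hχ : SmoothSpaceTime χ)
    (hsupp : tsupport χ ⊆ (univ ×ˢ Ioo (0 : ℝ) 1) ×ˢ Ioo (0 : ℝ) T)
    (q : (Torus d L × ℝ) × ℝ) (hq : q.2 ∈ Ioo 0 T) :
    timeDt (adjointSol u c T χ) q + u * cylDx (adjointSol u c T χ) q +
      c * adjointSol u c T χ q = χ q := by
  set ψ := adjointSol u c T χ with hψdef
  have hψ : SmoothSpaceTime ψ := smoothSpaceTime_adjointSol hχ hsupp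
  obtain ⟨q, rfl⟩ := isOpenQuotientMap_cover.surjective q
  set p : Torus d L × ℝ := (((q.1.1 - u * q.2 : ℝ) : Torus d L), q.1.2) with hp
  have hshear : ∀ t, shear u (p, t) = cover d L ((q.1.1 + u * (t - q.2), q.1.2), t) := by
    intro t
    simp only [shear_apply, cover, hp]
    rw [← AddCircle.coe_add, show q.1.1 - u * q.2 + u * t = q.1.1 + u * (t - q.2) by ring]
  have hq0 : shear u (p, q.2) = cover d L q := by rw [hshear]; simp
  have hc : HasDerivAt (fun t : ℝ => ((q.1.1 + u * (t - q.2), q.1.2), t))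
      ((u, (0 : ℝ)), (1 : ℝ)) q.2 := by
    refine HasDerivAt.prodMk (HasDerivAt.prodMk ?_ (hasDerivAt_const _ _)) (hasDerivAt_id _)
    simpa using (((hasDerivAt_id q.2).sub_const q.2).const_mul u).const_add q.1.1
  have h1 := HasFDerivAt.comp_hasDerivAt_of_eq q.2 (hψ.hasFDerivAt q) hc (by simp)
  have hcont : Continuous fun τ => Real.exp (c * τ) * χ (shear u (p, τ)) := by
    have h2 : Continuous fun τ => χ (shear u (p, τ)) := by
      simp only [hshear]
      exact hχ.continuous.comp (continuous_cover.comp (by fun_prop))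
    exact Continuous.mul (by fun_prop) h2
  have h2 : HasDerivAt (fun t => Real.exp (-c * t) *
      ∫ τ in 0..t, Real.exp (c * τ) * χ (shear u (p, τ)))
      (Real.exp (-c * q.2) * (-c) * (∫ τ in 0..q.2, Real.exp (c * τ) * χ (shear u (p, τ))) +
        Real.exp (-c * q.2) * (Real.exp (c * q.2) * χ (shear u (p, q.2)))) q.2 := by
    refine HasDerivAt.mul ?_ (hcont.integral_hasStrictDerivAt 0 q.2).hasDerivAt
    simpa using ((hasDerivAt_id q.2).const_mul (-c)).exp
  have hform : ∀ t ∈ Icc 0 T, ψ (shear u (p, t)) =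
      Real.exp (-c * t) * ∫ τ in 0..t, Real.exp (c * τ) * χ (shear u (p, τ)) := by
    intro t ht
    rw [hψdef, adjointSol_shear hsupp p ht, ← intervalIntegral.integral_const_mul]
    congr 1; ext τ
    rw [← mul_assoc, ← Real.exp_add]
    congr 2; ring
  have h3 := h2.congr_of_eventuallyEq (f₁ := fun t => ψ (shear u (p, t))) (by
    filter_upwards [isOpen_Ioo.mem_nhds hq] with t ht
    exact hform t (Ioo_subset_Icc_self ht))
  have hfun : ((ψ ∘ cover d L) ∘ fun t : ℝ => ((q.1.1 + u * (t - q.2), q.1.2), t)) =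
      fun t => ψ (shear u (p, t)) := by
    ext t; simp only [Function.comp_apply, hshear]
  rw [hfun] at h1
  rw [timeDt_add_mul_cylDx_cover hψ, h1.unique h3, ← hq0, hform q.2 (Ioo_subset_Icc_self hq),
    ← mul_assoc (Real.exp _) (Real.exp _), ← Real.exp_add]
  simp
  ring

variable [Fact (0 < d + 2 * L)]

/-- The flow is horizontal, so the `z`-support is that of `χ`. It propagates only forward in time,
so the solution vanishes before the least time `ε` of the support of `χ`. -/
theorem adjointSol_support (hχ : HasCompactSupport χ)
    (hsupp : tsupport χ ⊆ (univ ×ˢ Ioo (0 : ℝ) 1) ×ˢ Ioo (0 : ℝ) T) :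
    HasCompactSupport (adjointSol u c T χ) ∧
      tsupport (adjointSol u c T χ) ⊆ (univ ×ˢ Ioo (0 : ℝ) 1) ×ˢ Ioi (0 : ℝ) := by
  have hz := hχ.isCompact.image (f := fun q : (Torus d L × ℝ) × ℝ => q.1.2) (by fun_prop)
  have ht := hχ.isCompact.image (f := fun q : (Torus d L × ℝ) × ℝ => q.2) (by fun_prop)
  set Kz := (fun q : (Torus d L × ℝ) × ℝ => q.1.2) '' tsupport χ
  set Kt := (fun q : (Torus d L × ℝ) × ℝ => q.2) '' tsupport χ
  obtain ⟨ε, hε, hεt⟩ : ∃ ε > 0, ∀ t ∈ Kt, ε ≤ t := by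
    rcases Kt.eq_empty_or_nonempty with h | h
    · exact ⟨1, one_pos, by simp [h]⟩
    · obtain ⟨m, hm⟩ := ht.exists_isLeast h
      obtain ⟨q, hq, rfl⟩ := hm.1
      exact ⟨q.2, (hsupp hq).2.1, hm.2⟩
  have hC : IsCompact ((univ ×ˢ Kz) ×ˢ Icc ε (T + 2) : Set ((Torus d L × ℝ) × ℝ)) :=
    (isCompact_univ.prod hz).prod isCompact_Icc
  have hsub : tsupport (adjointSol u c T χ) ⊆ (univ ×ˢ Kz) ×ˢ Icc ε (T + 2) := by
    refine closure_minimal ?_ hC.isClosed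
    intro q hq
    have hq1 := left_ne_zero_of_mul hq
    have hq2 := right_ne_zero_of_mul hq
    have ht2 : q.2 ≤ T + 2 := by
      by_contra hc
      exact hq1 (Real.smoothTransition.zero_of_nonpos (by linarith))
    obtain ⟨r, hr⟩ : ∃ r, (Ici (0 : ℝ)).indicator (fun r => Real.exp (-c * r)) r *
        χ ((q.1.1 - ((u * r : ℝ) : Torus d L), q.1.2), q.2 - r) ≠ 0 := by
      by_contra! hc
      exact hq2 (by simp only [hc, integral_zero])
    have hr0 : 0 ≤ r := by
      by_contra hc
      exact left_ne_zero_of_mul hr (indicator_of_notMem (by simpa using hc) _)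
    have hmem := subset_tsupport _ (right_ne_zero_of_mul hr)
    have h1 := hεt _ ⟨_, hmem, rfl⟩
    exact ⟨⟨mem_univ _, ⟨_, hmem, rfl⟩⟩, by simp only at h1; linarith, ht2⟩
  refine ⟨hC.of_isClosed_subset (isClosed_tsupport _) hsub, hsub.trans ?_⟩
  rintro q ⟨⟨-, q', hq', hz'⟩, hqt⟩
  exact ⟨⟨mem_univ _, hz' ▸ (hsupp hq').1.2⟩, hε.trans_le hqt.1⟩

end Adjoint

/-! ### Weak solutions and their gradients -/

section Weak

variable {d L u c T : ℝ}

/-- A smooth cut-off in time, vanishing near `T` and converging to `1` on `(-∞, T)`. -/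
noncomputable def timeCutoff (T : ℝ) (n : ℕ) (t : ℝ) : ℝ :=
  Real.smoothTransition (n * (T - t) - 1)

/-- Multiplying by a time cut-off turns a test function into one vanishing near `T`. -/
theorem timeCutoff_mul_test {ψ : (Torus d L × ℝ) × ℝ → ℝ} (hψ : SmoothSpaceTime ψ)
    (hψc : HasCompactSupport ψ) (hψs : tsupport ψ ⊆ (univ ×ˢ Ioo (0 : ℝ) 1) ×ˢ Ioi (0 : ℝ))
    (n : ℕ) :
    SmoothSpaceTime (fun q => timeCutoff T n q.2 * ψ q) ∧
      HasCompactSupport (fun q => timeCutoff T n q.2 * ψ q) ∧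
      tsupport (fun q => timeCutoff T n q.2 * ψ q) ⊆
        (univ ×ˢ Ioo (0 : ℝ) 1) ×ˢ Ioo (0 : ℝ) T := by
  have hκ : ContDiff ℝ ∞ fun q : (ℝ × ℝ) × ℝ => timeCutoff T n q.2 :=
    Real.smoothTransition.contDiff.comp (by fun_prop)
  refine ⟨hκ.mul hψ, hψc.mul_left, fun q hq => ?_⟩
  have h1 := hψs (tsupport_mul_subset_right hq)
  refine ⟨h1.1, h1.2, ?_⟩
  have hcl : IsClosed {q : (Torus d L × ℝ) × ℝ | 1 ≤ n * (T - q.2)} :=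
    isClosed_le (by fun_prop) (by fun_prop)
  have h2 : tsupport (fun q => timeCutoff T n q.2 * ψ q) ⊆ {q | 1 ≤ n * (T - q.2)} := by
    refine closure_minimal (fun q hq => ?_) hcl
    by_contra hc
    refine left_ne_zero_of_mul hq (Real.smoothTransition.zero_of_nonpos ?_)
    have : ¬ 1 ≤ n * (T - q.2) := hc
    linarith
  have h3 : (1 : ℝ) ≤ n * (T - q.2) := h2 hq
  by_contra hc
  nlinarith [Nat.cast_nonneg (α := ℝ) n]

theorem cylDx_timeCutoff_mul (ψ : (Torus d L × ℝ) × ℝ → ℝ) (n : ℕ)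
    (q : (Torus d L × ℝ) × ℝ) :
    cylDx (fun q => timeCutoff T n q.2 * ψ q) q = timeCutoff T n q.2 * cylDx ψ q := by
  simp only [cylDx, spaceDx, deriv_const_mul_field]

theorem cylDz_timeCutoff_mul (ψ : (Torus d L × ℝ) × ℝ → ℝ) (n : ℕ)
    (q : (Torus d L × ℝ) × ℝ) :
    cylDz (fun q => timeCutoff T n q.2 * ψ q) q = timeCutoff T n q.2 * cylDz ψ q := by
  simp only [cylDz, spaceDz, deriv_const_mul_field]

/-- The slice at time `t` of a space-time test function is a test function. -/
theorem slice_test {ψ : (Torus d L × ℝ) × ℝ → ℝ} (hψ : SmoothSpaceTime ψ)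
    (hψc : HasCompactSupport ψ) (hψs : tsupport ψ ⊆ (univ ×ˢ Ioo (0 : ℝ) 1) ×ˢ Ioi (0 : ℝ))
    (t : ℝ) : SmoothSpace (fun p => ψ (p, t)) ∧ HasCompactSupport (fun p => ψ (p, t)) ∧
      tsupport (fun p => ψ (p, t)) ⊆ univ ×ˢ Ioo (0 : ℝ) 1 := by
  have hsub : tsupport (fun p => ψ (p, t)) ⊆ (fun p => (p, t)) ⁻¹' tsupport ψ :=
    closure_minimal (fun p hp => subset_tsupport ψ hp)
      ((isClosed_tsupport ψ).preimage (by fun_prop))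
  refine ⟨?_, ?_, fun p hp => (hψs (hsub hp)).1⟩
  · exact ContDiff.comp (g := fun q : (ℝ × ℝ) × ℝ => ψ (((q.1.1 : Torus d L), q.1.2), q.2)) hψ
      (contDiff_id.prodMk contDiff_const)
  · refine (hψc.isCompact.image continuous_fst).of_isClosed_subset (isClosed_tsupport _) ?_
    intro p hp
    exact ⟨(p, t), hsub hp, rfl⟩

variable [Fact (0 < d + 2 * L)]

theorem ae_cylMeasure_mem_Ioo : ∀ᵐ q ∂cylMeasure d L T, q.2 ∈ Ioo 0 T :=
  (Measure.quasiMeasurePreserving_snd (μ := channelMeasure d L)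
    (ν := volume.restrict (Ioo 0 T))).ae (ae_restrict_mem measurableSet_Ioo)

theorem integrable_mul_test {f χ : (Torus d L × ℝ) × ℝ → ℝ} (hf : MemLp f 2 (cylMeasure d L T))
    (hχ : Continuous χ) (hc : HasCompactSupport χ) :
    Integrable (fun q => f q * χ q) (cylMeasure d L T) := by
  obtain ⟨B, hB⟩ := hc.exists_bound_of_continuous hχ
  exact (hf.integrable (by norm_num)).mul_bdd (c := B) hχ.measurable.aestronglyMeasurable
    (ae_of_all _ hB)

/-- Duality between Duhamel's formula and the adjoint problem. -/
theorem integral_transportSol_mul (hT : 0 ≤ T) {a : Torus d L × ℝ → ℝ}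
    {F χ : (Torus d L × ℝ) × ℝ → ℝ} (ha : MemLp a 2 (channelMeasure d L))
    (hF : MemLp F 2 (cylMeasure d L T)) (hχ : SmoothSpaceTime χ) (hc : HasCompactSupport χ)
    (hsupp : tsupport χ ⊆ (univ ×ˢ Ioo (0 : ℝ) 1) ×ˢ Ioo (0 : ℝ) T) :
    ∫ q, transportSol u c T a F q * χ q ∂cylMeasure d L T =
      (∫ q, F q * adjointSol u c T χ q ∂cylMeasure d L T) +
        ∫ p, a p * adjointSol u c T χ (p, T) ∂channelMeasure d L := by
  have hψ := smoothSpaceTime_adjointSol (u := u) (c := c) hχ hsupp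
  have hψc := (adjointSol_support (u := u) (c := c) hc hsupp).1
  obtain ⟨B₁, hB₁⟩ := hc.exists_bound_of_continuous hχ.continuous
  obtain ⟨B₂, hB₂⟩ := hψc.exists_bound_of_continuous hψ.continuous
  have hmain := integral_duhamel_mul (c := c) (B := max B₁ B₂) hT
    (ha.comp_measurePreserving (measurePreserving_translate (u * T)))
    (hF.comp_measurePreserving (measurePreserving_shear u T))
    (hχ.continuous.measurable.comp (shear u).measurable)
    (hψ.continuous.measurable.comp (shear u).measurable)
    (fun q => (hB₁ _).trans (le_max_left _ _)) (fun q => (hB₂ _).trans (le_max_right _ _))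
    (fun p t ht => adjointSol_shear hsupp p ht)
  rw [← (measurePreserving_shear u T).integral_comp', ← (measurePreserving_shear u T).integral_comp'
    (fun q => F q * adjointSol u c T χ q),
    ← (measurePreserving_translate (u * T)).integral_comp'
      (fun p => a p * adjointSol u c T χ (p, T))]
  simp only [transportSol_shear]
  exact hmain

/-- The equation for `ψ` is needed only on `(0,T)`, the times charged by `cylMeasure`; the adjoint
solution violates it where its cut-off acts. -/
theorem IsWeakSolution.integral_mul {σT : Torus d L × ℝ → ℝ}
    {f σ χ ψ : (Torus d L × ℝ) × ℝ → ℝ} (hσ : IsWeakSolution u c T σT f σ)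
    (hψ : SmoothSpaceTime ψ) (hψc : HasCompactSupport ψ)
    (hψs : tsupport ψ ⊆ (univ ×ˢ Ioo (0 : ℝ) 1) ×ˢ Ioi (0 : ℝ))
    (hL : ∀ q, q.2 ∈ Ioo 0 T → timeDt ψ q + u * cylDx ψ q + c * ψ q = χ q) :
    ∫ q, σ q * χ q ∂cylMeasure d L T =
      (∫ q, f q * ψ q ∂cylMeasure d L T) + ∫ p, σT p * ψ (p, T) ∂channelMeasure d L := by
  rw [← hσ.weak_eq ψ hψ hψc hψs]
  refine integral_congr_ae ?_
  filter_upwards [ae_cylMeasure_mem_Ioo] with q hq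
  rw [hL q hq]

theorem ae_eq_of_forall_test {f g : (Torus d L × ℝ) × ℝ → ℝ} (hf : MemLp f 2 (cylMeasure d L T))
    (hg : MemLp g 2 (cylMeasure d L T))
    (h : ∀ χ : (Torus d L × ℝ) × ℝ → ℝ, SmoothSpaceTime χ → HasCompactSupport χ →
      tsupport χ ⊆ (univ ×ˢ Ioo (0 : ℝ) 1) ×ˢ Ioo (0 : ℝ) T →
      ∫ q, f q * χ q ∂(cylMeasure d L T) = ∫ q, g q * χ q ∂(cylMeasure d L T)) :
    f =ᵐ[cylMeasure d L T] g := by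
  have h0 := ae_eq_zero_of_forall_test ((hf.sub hg).integrable (by norm_num))
    fun χ hχ hc hs => by
      simp only [Pi.sub_apply, sub_mul]
      rw [integral_sub (integrable_mul_test hf hχ.continuous hc)
        (integrable_mul_test hg hχ.continuous hc), h χ hχ hc hs, sub_self]
  filter_upwards [h0] with q hq
  exact sub_eq_zero.1 hq

/-- Weak solutions are given by Duhamel's formula. -/
theorem IsWeakSolution.ae_eq_transportSol (hT : 0 ≤ T) {σT : Torus d L × ℝ → ℝ}
    {f σ : (Torus d L × ℝ) × ℝ → ℝ} (hσ : IsWeakSolution u c T σT f σ)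
    (hσT : MemLp σT 2 (channelMeasure d L)) (hf : MemLp f 2 (cylMeasure d L T)) :
    σ =ᵐ[cylMeasure d L T] transportSol u c T σT f := by
  refine ae_eq_of_forall_test hσ.memLp (memLp_transportSol hT hσT hf) fun χ hχ hc hs => ?_
  -- Paired with `χ`, both functions give the same expression in the data `f`, `σT` and the adjoint
  -- solution.
  obtain ⟨hψc, hψs⟩ := adjointSol_support (u := u) (c := c) hc hs
  rw [integral_transportSol_mul hT hσT hf hχ hc hs,
    hσ.integral_mul (smoothSpaceTime_adjointSol hχ hs) hψc hψs (adjointSol_eq hχ hs)]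

/-- Taking a component commutes with the Bochner integral when the slice is integrable, which holds
on almost every characteristic only. -/
theorem ae_transportSol_apply {a : Torus d L × ℝ → EuclideanSpace ℝ (Fin 2)}
    {F : (Torus d L × ℝ) × ℝ → EuclideanSpace ℝ (Fin 2)}
    (hF : MemLp F 2 (cylMeasure d L T)) (i : Fin 2) :
    ∀ᵐ q ∂cylMeasure d L T, transportSol u c T a F q i =
      transportSol u c T (fun p => a p i) (fun q => F q i) q := by
  have hFs : MemLp (F ∘ shear u) 2 (cylMeasure d L T) :=
    hF.comp_measurePreserving (measurePreserving_shear u T)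
  refine (measurePreserving_shear_symm u T).quasiMeasurePreserving.ae
    (p := fun q => duhamel c T (a ∘ translate (u * T)) (F ∘ shear u) q i =
      duhamel c T ((fun p => a p i) ∘ translate (u * T)) ((fun q => F q i) ∘ shear u) q) ?_
  have hp := (Measure.quasiMeasurePreserving_fst (μ := channelMeasure d L)
    (ν := volume.restrict (Ioo 0 T))).ae (ae_integrableOn_slice_of_memLp hFs)
  filter_upwards [hp, ae_cylMeasure_mem_Ioo] with q hq ht
  have hii := intervalIntegrable_exp_smul c q.2 hq (Ioo_subset_Icc_self ht)
    (right_mem_Icc.2 (ht.1.trans ht.2).le)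
  have h := (EuclideanSpace.proj i : EuclideanSpace ℝ (Fin 2) →L[ℝ] ℝ).intervalIntegral_comp_comm
    hii
  simp only [duhamel, PiLp.add_apply, PiLp.smul_apply, Function.comp_apply]
  congr 1
  simp only [PiLp.proj_apply, PiLp.smul_apply, Function.comp_apply] at h
  exact h.symm

theorem tendsto_integral_timeCutoff {F : (Torus d L × ℝ) × ℝ → ℝ}
    (hF : Integrable F (cylMeasure d L T)) :
    Filter.Tendsto (fun n : ℕ => ∫ q, timeCutoff T n q.2 * F q ∂cylMeasure d L T) Filter.atTop
      (nhds (∫ q, F q ∂cylMeasure d L T)) := by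
  refine tendsto_integral_of_dominated_convergence (fun q => ‖F q‖) (fun n => ?_) hF.norm
    (fun n => ae_of_all _ fun q => ?_) ?_
  · refine AEStronglyMeasurable.mul (Continuous.aestronglyMeasurable ?_) hF.1
    exact Real.smoothTransition.continuous.comp (by fun_prop)
  · rw [norm_mul]
    refine mul_le_of_le_one_left (norm_nonneg _) ?_
    rw [timeCutoff, Real.norm_of_nonneg (Real.smoothTransition.nonneg _)]
    exact Real.smoothTransition.le_one _
  · filter_upwards [ae_cylMeasure_mem_Ioo] with q hq
    refine tendsto_const_nhds.congr' ?_
    obtain ⟨N, hN⟩ := exists_nat_ge (2 / (T - q.2))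
    filter_upwards [Filter.eventually_ge_atTop N] with n hn
    have hpos : 0 < T - q.2 := sub_pos.2 hq.2
    have h2 : 2 ≤ n * (T - q.2) := by
      rw [div_le_iff₀ hpos] at hN
      have : (N : ℝ) ≤ n := by exact_mod_cast hn
      nlinarith
    rw [timeCutoff, Real.smoothTransition.one_of_one_le (by linarith), one_mul]

/-- The weak gradient of `f` is tested only with functions vanishing near `t = T`, whereas the
adjoint solution need not vanish there. The identity with cut-offs passes to the limit. -/
theorem integral_mul_eq_neg_of_timeCutoff {f ψ' g ψ : (Torus d L × ℝ) × ℝ → ℝ}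
    (h1 : Integrable (fun q => f q * ψ' q) (cylMeasure d L T))
    (h2 : Integrable (fun q => g q * ψ q) (cylMeasure d L T))
    (h : ∀ n : ℕ, ∫ q, f q * (timeCutoff T n q.2 * ψ' q) ∂cylMeasure d L T =
      -∫ q, g q * (timeCutoff T n q.2 * ψ q) ∂cylMeasure d L T) :
    ∫ q, f q * ψ' q ∂cylMeasure d L T = -∫ q, g q * ψ q ∂cylMeasure d L T := by
  refine tendsto_nhds_unique (tendsto_integral_timeCutoff h1) ?_
  refine (tendsto_integral_timeCutoff h2).neg.congr fun n => ?_
  simpa only [mul_left_comm] using (h n).symm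

theorem memLp_apply {α : Type*} [MeasurableSpace α] {m : Measure α}
    {g : α → EuclideanSpace ℝ (Fin 2)} (hg : MemLp g 2 m) (i : Fin 2) :
    MemLp (fun x => g x i) 2 m :=
  (EuclideanSpace.proj i : EuclideanSpace ℝ (Fin 2) →L[ℝ] ℝ).comp_memLp' hg

/-- Uniqueness of the weak gradient transfers an estimate proved for one gradient to every other. -/
theorem HasL2Gradient.ae_eq {v : (Torus d L × ℝ) × ℝ → ℝ}
    {g g' : (Torus d L × ℝ) × ℝ → EuclideanSpace ℝ (Fin 2)} (h : HasL2Gradient T v g)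
    (h' : HasL2Gradient T v g') : g =ᵐ[cylMeasure d L T] g' := by
  have h0 : (fun q => g q 0) =ᵐ[cylMeasure d L T] fun q => g' q 0 :=
    ae_eq_of_forall_test (memLp_apply h.memLp_grad 0) (memLp_apply h'.memLp_grad 0)
      fun χ hχ hc hs => neg_injective ((h.weak_dx χ hχ hc hs).symm.trans (h'.weak_dx χ hχ hc hs))
  have h1 : (fun q => g q 1) =ᵐ[cylMeasure d L T] fun q => g' q 1 :=
    ae_eq_of_forall_test (memLp_apply h.memLp_grad 1) (memLp_apply h'.memLp_grad 1)
      fun χ hχ hc hs => neg_injective ((h.weak_dz χ hχ hc hs).symm.trans (h'.weak_dz χ hχ hc hs))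
  filter_upwards [h0, h1] with q hq0 hq1
  ext i
  fin_cases i
  · exact hq0
  · exact hq1

/-- The integration by parts behind the regularity of weak solutions, in one direction `v`. -/
theorem IsWeakSolution.integral_mul_dirDeriv (hT : 0 ≤ T) {σT gT : Torus d L × ℝ → ℝ}
    {f σ g χ χ' ψ' : (Torus d L × ℝ) × ℝ → ℝ} {v : (ℝ × ℝ) × ℝ}
    (hσ : IsWeakSolution u c T σT f σ)
    (hgT : MemLp gT 2 (channelMeasure d L)) (hg : MemLp g 2 (cylMeasure d L T))
    (hχ : SmoothSpaceTime χ) (hc : HasCompactSupport χ)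
    (hs : tsupport χ ⊆ (univ ×ˢ Ioo (0 : ℝ) 1) ×ˢ Ioo (0 : ℝ) T)
    (hχ' : IsDirDeriv v χ χ') (hψ' : IsDirDeriv v (adjointSol u c T χ) ψ')
    (h1 : ∫ q, f q * ψ' q ∂cylMeasure d L T =
      -∫ q, g q * adjointSol u c T χ q ∂cylMeasure d L T)
    (h2 : ∫ p, σT p * ψ' (p, T) ∂channelMeasure d L =
      -∫ p, gT p * adjointSol u c T χ (p, T) ∂channelMeasure d L) :
    ∫ q, σ q * χ' q ∂cylMeasure d L T =
      -∫ q, transportSol u c T gT g q * χ q ∂cylMeasure d L T := by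
  have hψ := smoothSpaceTime_adjointSol (u := u) (c := c) hχ hs
  obtain ⟨hψc, hψs⟩ := adjointSol_support (u := u) (c := c) hc hs
  rw [hσ.integral_mul (hψ'.smooth hψ)
    (hψc.of_isClosed_subset (isClosed_tsupport _) hψ'.tsupport_subset)
    (hψ'.tsupport_subset.trans hψs) (hψ'.transport_eq hχ' hψ (adjointSol_eq hχ hs)),
    integral_transportSol_mul hT hgT hg hχ hc hs, h1, h2]
  ring

/-- The gradient of a weak solution solves the transport equation with differentiated data. -/
theorem IsWeakSolution.hasL2Gradient (hT : 0 ≤ T) {σT : Torus d L × ℝ → ℝ}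
    {gT : Torus d L × ℝ → EuclideanSpace ℝ (Fin 2)} {f σ : (Torus d L × ℝ) × ℝ → ℝ}
    {g : (Torus d L × ℝ) × ℝ → EuclideanSpace ℝ (Fin 2)}
    (hσ : IsWeakSolution u c T σT f σ) (hgT : MemLp gT 2 (channelMeasure d L))
    (hweak : ∀ ψ : Torus d L × ℝ → ℝ, SmoothSpace ψ → HasCompactSupport ψ →
      tsupport ψ ⊆ univ ×ˢ Ioo (0 : ℝ) 1 →
      (∫ p, σT p * spaceDx ψ p ∂(channelMeasure d L) =
        -∫ p, gT p 0 * ψ p ∂(channelMeasure d L)) ∧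
      (∫ p, σT p * spaceDz ψ p ∂(channelMeasure d L) =
        -∫ p, gT p 1 * ψ p ∂(channelMeasure d L)))
    (hf : HasL2Gradient T f g) : HasL2Gradient T σ (transportSol u c T gT g) := by
  have hcomp : ∀ (i : Fin 2) (χ : (Torus d L × ℝ) × ℝ → ℝ),
      ∫ q, transportSol u c T gT g q i * χ q ∂cylMeasure d L T =
        ∫ q, transportSol u c T (fun p => gT p i) (fun q => g q i) q * χ q
          ∂cylMeasure d L T := by
    intro i χ
    refine integral_congr_ae ?_
    filter_upwards [ae_transportSol_apply (u := u) (c := c) (a := gT) hf.memLp_grad i] with q hq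
    rw [hq]
  refine ⟨hσ.memLp, memLp_transportSol hT hgT hf.memLp_grad, fun χ hχ hc hs => ?_,
    fun χ hχ hc hs => ?_⟩
  · have hψ := smoothSpaceTime_adjointSol (u := u) (c := c) hχ hs
    obtain ⟨hψc, hψs⟩ := adjointSol_support (u := u) (c := c) hc hs
    have hdir := isDirDeriv_cylDx hψ
    obtain ⟨s1, s2, s3⟩ := slice_test hψ hψc hψs T
    rw [hcomp]
    refine hσ.integral_mul_dirDeriv hT (memLp_apply hgT 0) (memLp_apply hf.memLp_grad 0) hχ hc hs
      (isDirDeriv_cylDx hχ) hdir ?_ (hweak _ s1 s2 s3).1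
    -- The source term: the cut-off depends on time alone, so it commutes with the spatial
    -- derivative. The terminal term was settled by the slice of `ψ` at time `T`.
    refine integral_mul_eq_neg_of_timeCutoff
      (integrable_mul_test hf.memLp (hdir.smooth hψ).continuous
        (hψc.of_isClosed_subset (isClosed_tsupport _) hdir.tsupport_subset))
      (integrable_mul_test (memLp_apply hf.memLp_grad 0) hψ.continuous hψc) fun n => ?_
    obtain ⟨k1, k2, k3⟩ := timeCutoff_mul_test (T := T) hψ hψc hψs n
    rw [← hf.weak_dx _ k1 k2 k3]
    simp only [cylDx_timeCutoff_mul]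
  · have hψ := smoothSpaceTime_adjointSol (u := u) (c := c) hχ hs
    obtain ⟨hψc, hψs⟩ := adjointSol_support (u := u) (c := c) hc hs
    have hdir := isDirDeriv_cylDz hψ
    obtain ⟨s1, s2, s3⟩ := slice_test hψ hψc hψs T
    rw [hcomp]
    refine hσ.integral_mul_dirDeriv hT (memLp_apply hgT 1) (memLp_apply hf.memLp_grad 1) hχ hc hs
      (isDirDeriv_cylDz hχ) hdir ?_ (hweak _ s1 s2 s3).2
    refine integral_mul_eq_neg_of_timeCutoff
      (integrable_mul_test hf.memLp (hdir.smooth hψ).continuous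
        (hψc.of_isClosed_subset (isClosed_tsupport _) hdir.tsupport_subset))
      (integrable_mul_test (memLp_apply hf.memLp_grad 1) hψ.continuous hψc) fun n => ?_
    obtain ⟨k1, k2, k3⟩ := timeCutoff_mul_test (T := T) hψ hψc hψs n
    rw [← hf.weak_dz _ k1 k2 k3]
    simp only [cylDz_timeCutoff_mul]

/-! ### Transfer of the estimate between almost everywhere equal functions -/

variable {E : Type*} [NormedAddCommGroup E] [NormedSpace ℝ E]

/-- The norm is computed on time slices, so almost everywhere equality has to be disintegrated with
time as the outer variable; hence the swap. -/
theorem normLinftyL2_weighted_congr (η : Torus d L → ℝ) (θ : ℝ → ℝ) (s lam r : ℝ)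
    {v w : (Torus d L × ℝ) × ℝ → E} (h : v =ᵐ[cylMeasure d L T] w) :
    normLinftyL2 T (weighted u T η θ s lam r v) = normLinftyL2 T (weighted u T η θ s lam r w) := by
  refine essSup_congr_ae ?_
  have h' : ∀ᵐ q ∂(volume.restrict (Ioo 0 T)).prod (channelMeasure d L), v q.swap = w q.swap :=
    (Measure.measurePreserving_swap (μ := volume.restrict (Ioo 0 T))
      (ν := channelMeasure d L)).quasiMeasurePreserving.ae h
  filter_upwards [Measure.ae_ae_of_ae_prod h'] with t ht
  refine eLpNorm_congr_ae ?_
  filter_upwards [ht] with p hp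
  have : v (p, t) = w (p, t) := hp
  simp only [weighted, this]

theorem eLpNorm_weighted_obs_congr (hL : 0 < L) (η : Torus d L → ℝ) (θ : ℝ → ℝ) (s lam r : ℝ)
    {v w : (Torus d L × ℝ) × ℝ → E} (h : v =ᵐ[cylMeasure d L T] w) :
    eLpNorm (weighted u T η θ s lam r v) 2 (obsMeasure d L T) =
      eLpNorm (weighted u T η θ s lam r w) 2 (obsMeasure d L T) := by
  rw [obsMeasure_eq_restrict hL]
  refine eLpNorm_congr_ae (ae_restrict_of_ae ?_)
  filter_upwards [h] with q hq
  simp only [weighted, hq]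

end Weak
end CarlemanTransport

theorem mainTheorem8
    (d u₁ T L a γ ρbar μ μ' T₀ T₁ : ℝ)
    (hd : 0 < d) (hu₁ : 0 < u₁) (hT : d / u₁ < T) (hL : L = 3 * u₁ * T)
    (ha : 0 < a) (hγ : 1 < γ) (hρ : 0 < ρbar) (hμ : 0 < μ) (hν : 0 < μ' + 2 * μ)
    (hT₀ : 0 < T₀) (hT₁ : 0 < T₁) (hT₀₁ : 2 * T₀ + 2 * T₁ < T - d / u₁)
    [Fact (0 < d + 2 * L)]
    (η : Torus d L → ℝ) (hη : IsSpaceWeight u₁ T η)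
    (θ : ℝ → ℝ) (hθ : IsTimeWeight T T₀ T₁ θ) :
    (∃ C : ℝ, 0 < C ∧
      ∀ (σT : Torus d L × ℝ → ℝ) (f σ : (Torus d L × ℝ) × ℝ → ℝ) (s lam : ℝ),
        1 ≤ s → 1 ≤ lam →
        MemLp σT 2 (channelMeasure d L) → MemLp f 2 (cylMeasure d L T) →
        IsWeakSolution u₁ (reaction a γ ρbar μ μ') T σT f σ →
        normLinftyL2 T (weighted u₁ T η θ s lam (-(3 / 2)) σ) ^ 2 ≤
          ENNReal.ofReal C *
            (eLpNorm (weighted u₁ T η θ s lam (-(1 / 2)) f) 2 (cylMeasure d L T) ^ 2 +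
              ENNReal.ofReal (s * lam) *
                eLpNorm (weighted u₁ T η θ s lam (-(1 / 2)) σ) 2 (obsMeasure d L T) ^ 2)) ∧
    (∃ C : ℝ, 0 < C ∧
      ∀ (σT : Torus d L × ℝ → ℝ) (f σ : (Torus d L × ℝ) × ℝ → ℝ)
        (gradf : (Torus d L × ℝ) × ℝ → EuclideanSpace ℝ (Fin 2)) (s lam : ℝ),
        1 ≤ s → 1 ≤ lam →
        MemH1 σT → HasL2Gradient T f gradf →
        IsWeakSolution u₁ (reaction a γ ρbar μ μ') T σT f σ →
        (∃ gradσ, HasL2Gradient T σ gradσ) ∧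
        ∀ gradσ, HasL2Gradient T σ gradσ →
          normLinftyL2 T (weighted u₁ T η θ s lam (-(3 / 2)) gradσ) ^ 2 ≤
            ENNReal.ofReal C *
              (eLpNorm (weighted u₁ T η θ s lam (-(1 / 2)) gradf) 2 (cylMeasure d L T) ^ 2 +
                ENNReal.ofReal (s * lam) *
                  eLpNorm (weighted u₁ T η θ s lam (-(1 / 2)) gradσ) 2
                    (obsMeasure d L T) ^ 2)) := by

  have hT0 : 0 < T := (div_pos hd hu₁).trans hT
  have hL0 : 0 < L := by rw [hL]; positivity
  refine ⟨?_, ?_⟩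
  · obtain ⟨C, hC, hest⟩ := exists_const_transportSol_le (E := ℝ) (reaction a γ ρbar μ μ')
      hd hu₁ hT0 hL hT₀ hT₁ hT₀₁ hη hθ
    refine ⟨C, hC, fun σT f σ s lam hs hlam hσT hf hσ => ?_⟩
    have hae := hσ.ae_eq_transportSol hT0.le hσT hf
    rw [normLinftyL2_weighted_congr _ _ _ _ _ hae, eLpNorm_weighted_obs_congr hL0 _ _ _ _ _ hae]
    exact hest σT f s lam hs hlam hσT hf
  · obtain ⟨C, hC, hest⟩ := exists_const_transportSol_le (E := EuclideanSpace ℝ (Fin 2))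
      (reaction a γ ρbar μ μ') hd hu₁ hT0 hL hT₀ hT₁ hT₀₁ hη hθ
    refine ⟨C, hC, fun σT f σ gradf s lam hs hlam hσT hf hσ => ?_⟩
    obtain ⟨-, gT, hgT, hweak⟩ := hσT
    have hgrad := hσ.hasL2Gradient hT0.le hgT hweak hf
    refine ⟨⟨_, hgrad⟩, fun gradσ hgradσ => ?_⟩
    -- An arbitrary weak gradient of `σ` is identified with the Duhamel solution having data `gT`
    -- and `gradf`.
    have hae := hgradσ.ae_eq hgrad
    rw [normLinftyL2_weighted_congr _ _ _ _ _ hae, eLpNorm_weighted_obs_congr hL0 _ _ _ _ _ hae]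
    exact hest gT gradf s lam hs hlam hgT hf.memLp_grad
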